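/- A compact metric graph $G=(V,E)$ consists of finitely many edges, each a closed interval $[0,\ell_e]$ with $0<\ell_e<\infty$, glued together by identifying some of their endpoints (the nodes); multiple edges and self-loops are allowed, and $G$ is assumed connected. A terminal edge is an edge having an endpoint that is a node of degree one (a self-loop counts twice in the degree). A function $u:G\to\mathbb R$ is regarded as a family $(u_e)_{e\in E}$ of functions on $[0,\ell_e]$, and $\|u\|_p^p=\sum_{e}\int_0^{\ell_e}|u_e|^p\,dx$. Let $H^1(G)$ be the set of continuous $u:G\to\mathbb R$ with $u_e\in H^1(0,\ell_e)$ for every $e\in E$, let $u'=(u_e')_{e\in E}$ be the weak derivative, and for $\mu>0$ let $H^1_\mu(G)=\{u\in H^1(G):\|u\|_2^2=\mu\}$. Put $\mu_{\mathbb R^+}=\sqrt3\,\pi/4$. **Proposition.** Let $G$ be a connected compact metric graph with at least one terminal edge. There is a constant $C>0$, depending only on $G$, such that for every $\mu\in(0,\mu_{\mathbb R^+}]$ and every $u\in H^1_\mu(G)$ there exists $\theta=\theta(u)\in[0,\mu]$ with $$\|u\|_6^6\le 3\Big(\frac{\mu-\theta}{\mu_{\mathbb R^+}}\Big)^2\|u'\|_2^2+C\,\theta^{1/2}.$$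 -/

import Mathlib

open MeasureTheory Set
open scoped ContDiff

/-- A compact metric graph with nodes `V` and edges `E` (both types are assumed finite wherever the
structure is used): every edge `e` is an interval `[0, length e]` of positive finite length, glued
to the node `source e` at `0` and to the node `target e` at `length e`.
Multiple edges and self-loops are allowed. -/
structure CompactMetricGraph (V E : Type*) where
  source : E → V
  target : E → V
  length : E → ℝ
  length_pos : ∀ e, 0 < length e

namespace CompactMetricGraph

variable {V E : Type*} (G : CompactMetricGraph V E)

/-- The disjoint union of the nodes and of the closed edges, before gluing. -/
def PrePoint : Type _ := V ⊕ (Σ e : E, Icc (0 : ℝ) (G.length e))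

/-- The nodes are discrete; the edges are closed real intervals. -/
instance : TopologicalSpace G.PrePoint :=
  letI : TopologicalSpace V := ⊥
  inferInstanceAs (TopologicalSpace (V ⊕ (Σ e : E, Icc (0 : ℝ) (G.length e))))

/-- The two ends of an edge are identified with its end nodes. -/
inductive Glue : G.PrePoint → G.PrePoint → Prop
  | source (e : E) : Glue (Sum.inl (G.source e))
      (Sum.inr ⟨e, ⟨0, left_mem_Icc.2 (G.length_pos e).le⟩⟩)
  | target (e : E) : Glue (Sum.inl (G.target e))
      (Sum.inr ⟨e, ⟨G.length e, right_mem_Icc.2 (G.length_pos e).le⟩⟩)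

/-- The points of the metric graph. -/
def Point : Type _ := Quot G.Glue

/-- The metric graph carries the quotient topology. -/
instance : TopologicalSpace G.Point := inferInstanceAs (TopologicalSpace (Quot G.Glue))

/-- The point with coordinate `x` on the edge `e`. -/
def edgePoint (e : E) (x : Icc (0 : ℝ) (G.length e)) : G.Point := Quot.mk _ (Sum.inr ⟨e, x⟩)

/-- The degree of a node: the number of edge ends at it (a self-loop counts twice). -/
noncomputable def degree (v : V) : ℕ :=
  Nat.card {e : E // G.source e = v} + Nat.card {e : E // G.target e = v}

/-- A terminal edge: one of its end nodes has degree one. -/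
def IsTerminalEdge (e : E) : Prop := G.degree (G.source e) = 1 ∨ G.degree (G.target e) = 1

/-- The restriction `u_e` of `u` to the edge `e`, as a function of the coordinate in
`[0, length e]` (extended by its end values outside that interval). -/
noncomputable def edgeFun (u : C(G.Point, ℝ)) (e : E) (x : ℝ) : ℝ :=
  u (G.edgePoint e (projIcc 0 (G.length e) (G.length_pos e).le x))

/-- The `L^p` norm over the graph of a function given edge by edge. -/
noncomputable def normLp [Fintype E] (p : ℝ) (f : E → ℝ → ℝ) : ℝ :=
  (∑ e, ∫ x in (0 : ℝ)..G.length e, |f e x| ^ p) ^ (1 / p)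

/-- `g` is a weak derivative of `f` on the open interval `(0, l)`. -/
def IsWeakDeriv (l : ℝ) (f g : ℝ → ℝ) : Prop :=
  ∀ φ : ℝ → ℝ, ContDiff ℝ ∞ φ → HasCompactSupport φ → tsupport φ ⊆ Ioo 0 l →
    ∫ x in Ioo 0 l, f x * deriv φ x = - ∫ x in Ioo 0 l, g x * φ x

/-- `g` is, edge by edge, an `L²` weak derivative of `u`. -/
def HasL2WeakDeriv (u : C(G.Point, ℝ)) (g : E → ℝ → ℝ) : Prop :=
  ∀ e, MemLp (g e) 2 (volume.restrict (Ioo 0 (G.length e))) ∧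
    IsWeakDeriv (G.length e) (G.edgeFun u e) (g e)

/-- The space `H¹(G)`: continuous functions on the graph that are in `H¹` of every edge. -/
def H1 : Set C(G.Point, ℝ) :=
  {u | (∀ e, MemLp (G.edgeFun u e) 2 (volume.restrict (Ioo 0 (G.length e)))) ∧
    ∃ g, G.HasL2WeakDeriv u g}

open Classical in
/-- The weak derivative `u'` of `u`, edge by edge (unique up to null sets for `u ∈ H¹(G)`, and `0`
by convention for other `u`). -/
noncomputable def weakDeriv (u : C(G.Point, ℝ)) : E → ℝ → ℝ :=
  if h : ∃ g, G.HasL2WeakDeriv u g then h.choose else 0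

theorem hasL2WeakDeriv_weakDeriv {u : C(G.Point, ℝ)} (hu : u ∈ G.H1) :
    G.HasL2WeakDeriv u (G.weakDeriv u) := by
  have h := hu.2
  rw [weakDeriv, dif_pos h]
  exact h.choose_spec

/-- The space `H¹_μ(G)` of the functions `u ∈ H¹(G)` of mass `‖u‖₂² = μ`. -/
def H1Mass [Fintype E] (μ : ℝ) : Set C(G.Point, ℝ) :=
  {u | u ∈ G.H1 ∧ G.normLp 2 (G.edgeFun u) ^ 2 = μ}

end CompactMetricGraph

/-- The `L²`-critical mass on the half-line. -/
noncomputable def criticalMassHalfLine : ℝ := √3 * Real.pi / 4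

/-! Calibration replaces rearrangement. Put `w = |u|`, `dν = w² dx`, `F a = ν {w ≤ a}`. Fix a level
`t`, a margin `η > 0`, and on masses `s ∈ [F t, μ]` the field `c s = k cot (k (s - F t + η))`, with
`k` chosen so that `c μ = 0`. It solves `-c' = k² + c²`. The layer-cake formula for `w⁴` bounds
`∫_{w>t} (k² + c(F w)²) w⁶` by `t⁴ c(F t) + ∫_t^T 4τ³ c(F τ) dτ`, where `c(F t) ≤ 1/η`.
Connectedness makes `w` take every value between its extremes at least once, so the last integral is
at most `∫_{w>t} 4w³ c(F w) |u'|`, hence at most `4 ∫ |u'|² + ∫_{w>t} c(F w)² w⁶`. The `c²` terms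
cancel, leaving `k² ∫_{w>t} w⁶ ≤ 4 ‖u'‖² + t⁴/η` (`lintegral_pow_six_le_of_covering`). Counting each
value once is what yields the half-line constant: `4/k² = 16 (μ - F t + η)²/π²`. It remains to
choose `t`. If `min w > 0`, some level satisfies `t² ≲ (F t)^(3/4)` (`exists_level_sq_le`); with `θ
= η = F t / 2` the errors `t⁴/η` and `t⁴ F t` are `O(θ^(1/2))`. If `min w = 0`, let `t → 0` and take
`θ = 0`. -/

/-! ### Distribution functions compared with Lebesgue measure. -/

/-- An atom of the law of `f` is sent by the distribution function to the upper end of its jump, so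
mass only moves upwards; sets `J` closed downwards to `F τ` can therefore only lose mass. No
atomlessness is needed. -/
theorem measure_cdf_mem_le {X : Type*} [MeasurableSpace X] (ν : Measure X)
    [IsFiniteMeasure ν] {f : X → ℝ} (hf : Measurable f) (τ : ℝ) (J : Set ℝ)
    (hJ : ∀ s ∈ J, Ioc (ν.real {y | f y ≤ τ}) s ⊆ J) :
    ν {x | τ < f x ∧ ν.real {y | f y ≤ f x} ∈ J} ≤
      volume (J ∩ Ioc (ν.real {y | f y ≤ τ}) (ν.real univ)) := by
  set F : ℝ → ℝ := fun a => ν.real {y | f y ≤ a} with hF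
  have hsub : ∀ a b : ℝ, a ≤ b → {y | f y ≤ a} ⊆ {y | f y ≤ b} :=
    fun a b hab y (hy : f y ≤ a) => hy.trans hab
  have key : ∀ a, τ < a → F a ∈ J →
      ν {x | τ < f x ∧ f x ≤ a} ≤ volume (J ∩ Ioc (F τ) (ν.real univ)) := by
    intro a ha haJ
    have h1 : {x | τ < f x ∧ f x ≤ a} = {x | f x ≤ a} \ {x | f x ≤ τ} := by
      ext x; simp [and_comm]
    have h2 : ν.real {x | τ < f x ∧ f x ≤ a} = F a - F τ := by
      rw [h1]
      exact measureReal_sdiff (hsub _ _ ha.le) (hf measurableSet_Iic)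
    have h3 : Ioc (F τ) (F a) ⊆ J ∩ Ioc (F τ) (ν.real univ) := fun s hs =>
      ⟨hJ _ haJ hs, hs.1, hs.2.trans (measureReal_mono (subset_univ _))⟩
    calc ν {x | τ < f x ∧ f x ≤ a} = ENNReal.ofReal (F a - F τ) := by
          rw [← h2, ofReal_measureReal]
      _ = volume (Ioc (F τ) (F a)) := by rw [Real.volume_Ioc]
      _ ≤ _ := measure_mono h3
  set D : Set X := {x | τ < f x ∧ F (f x) ∈ J} with hD
  -- Either the top level of `D` is attained and `key` applies to it, or `D` is covered by a
  -- countable directed union of layers below rational levels.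
  by_cases hmax : ∃ y ∈ D, ∀ x ∈ D, f x ≤ f y
  · obtain ⟨y, hy, hy'⟩ := hmax
    refine (measure_mono ?_).trans (key (f y) hy.1 hy.2)
    exact fun x hx => ⟨hx.1, hy' x hx⟩
  · push Not at hmax
    let Q : Set ℚ := {q | ∃ y ∈ D, (q : ℝ) ≤ f y}
    have hcover : D ⊆ ⋃ q ∈ Q, {x | τ < f x ∧ f x ≤ (q : ℝ)} := by
      intro x hx
      obtain ⟨y, hy, hxy⟩ := hmax x hx
      obtain ⟨q, hq1, hq2⟩ := exists_rat_btwn hxy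
      have hq : q ∈ Q := ⟨y, hy, hq2.le⟩
      exact mem_iUnion₂.2 ⟨q, hq, hx.1, hq1.le⟩
    refine (measure_mono hcover).trans ?_
    rw [measure_biUnion_eq_iSup (to_countable Q)]
    · refine iSup₂_le fun q hq => ?_
      obtain ⟨y, hy, hqy⟩ := hq
      refine (measure_mono ?_).trans (key (f y) hy.1 hy.2)
      exact fun x hx => ⟨hx.1, hx.2.trans hqy⟩
    · intro p hp q hq
      rcases le_total p q with h | h
      · exact ⟨q, hq, fun x hx => ⟨hx.1, hx.2.trans (by exact_mod_cast h)⟩, subset_rfl⟩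
      · exact ⟨p, hp, subset_rfl, fun x hx => ⟨hx.1, hx.2.trans (by exact_mod_cast h)⟩⟩

theorem measurable_cdf {X : Type*} [MeasurableSpace X] (ν : Measure X)
    [IsFiniteMeasure ν] (f : X → ℝ) : Measurable fun a : ℝ => ν.real {y | f y ≤ a} :=
  Monotone.measurable fun a b hab =>
    measureReal_mono (fun y (hy : f y ≤ a) => hy.trans hab)

/-- If `F` is the distribution function of `f` under `ν`, the law of `F ∘ f` above the level `τ`
is dominated, on antitone functions, by the Lebesgue measure on `(F τ, ν univ]`. -/
theorem lintegral_comp_cdf_le {X : Type*} [MeasurableSpace X] (ν : Measure X)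
    [IsFiniteMeasure ν] {f : X → ℝ} (hf : Measurable f) (τ : ℝ) {h : ℝ → ℝ} (hm : Measurable h)
    (h0 : 0 ≤ h) (hanti : AntitoneOn h (Icc (ν.real {y | f y ≤ τ}) (ν.real univ))) :
    ∫⁻ x in {x | τ < f x}, ENNReal.ofReal (h (ν.real {y | f y ≤ f x})) ∂ν ≤
      ∫⁻ s in Ioc (ν.real {y | f y ≤ τ}) (ν.real univ), ENNReal.ofReal (h s) := by
  set F : ℝ → ℝ := fun a => ν.real {y | f y ≤ a} with hF
  have hFm : Measurable F := measurable_cdf ν f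
  have hhF : Measurable fun x => h (F (f x)) := hm.comp (hFm.comp hf)
  -- By the layer-cake formula it suffices to compare superlevel sets of `h`; these are closed
  -- downwards since `h` is antitone.
  rw [lintegral_eq_lintegral_meas_lt _ (Filter.Eventually.of_forall fun x => h0 (F (f x)))
      hhF.aemeasurable,
    lintegral_eq_lintegral_meas_lt _ (Filter.Eventually.of_forall fun x => h0 x) hm.aemeasurable]
  refine lintegral_mono fun r => ?_
  rw [Measure.restrict_apply (measurableSet_lt measurable_const hhF),
    Measure.restrict_apply (measurableSet_lt measurable_const hm)]
  set J : Set ℝ := {s | s ∈ Icc (F τ) (ν.real univ) ∧ r < h s} with hJ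
  have hle : ∀ a, F a ≤ ν.real univ := fun a => measureReal_mono (subset_univ _)
  have := measure_cdf_mem_le ν hf τ J (by
    rintro s ⟨hs, hr⟩ s' hs'
    have hs'' : s' ∈ Icc (F τ) (ν.real univ) := ⟨hs'.1.le, hs'.2.trans hs.2⟩
    exact ⟨hs'', hr.trans_le (hanti hs'' hs hs'.2)⟩)
  refine (measure_mono ?_).trans (this.trans (measure_mono ?_))
  · rintro x ⟨hx1, hx2⟩
    have hx2' : τ < f x := hx2
    exact ⟨hx2', ⟨measureReal_mono (fun y (hy : f y ≤ τ) => hy.trans hx2'.le), hle _⟩, hx1⟩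
  · exact fun s hs => ⟨hs.1.2, hs.2⟩

/-! ### The calibration argument. -/

/-- The primitive is `-k cot (k (s - b))`, which vanishes at `B`, where the angle is `π/2`. -/
theorem lintegral_inv_sin_sq {k b A B : ℝ} (hk : 0 < k) (hA : 0 < k * (A - b)) (hAB : A ≤ B)
    (hB : k * (B - b) = Real.pi / 2) :
    ∫⁻ s in Ioc A B, ENNReal.ofReal (k ^ 2 / Real.sin (k * (s - b)) ^ 2) =
      ENNReal.ofReal (k * Real.cos (k * (A - b)) / Real.sin (k * (A - b))) := by
  have hsin : ∀ s ∈ Icc A B, 0 < Real.sin (k * (s - b)) := by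
    intro s hs
    have h1 : k * (A - b) ≤ k * (s - b) := by gcongr; exact hs.1
    have h2 : k * (s - b) ≤ k * (B - b) := by gcongr; exact hs.2
    exact Real.sin_pos_of_pos_of_lt_pi (by linarith) (by linarith [Real.pi_pos])
  have hcont : ContinuousOn (fun s => k ^ 2 / Real.sin (k * (s - b)) ^ 2) (Icc A B) :=
    ContinuousOn.div (by fun_prop) (by fun_prop) fun s hs => (pow_pos (hsin s hs) 2).ne'
  have hint : IntervalIntegrable (fun s => k ^ 2 / Real.sin (k * (s - b)) ^ 2) volume A B :=
    hcont.intervalIntegrable_of_Icc hAB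
  have hder : ∀ s ∈ uIcc A B, HasDerivAt
      (fun s => -(k * Real.cos (k * (s - b)) / Real.sin (k * (s - b))))
      (k ^ 2 / Real.sin (k * (s - b)) ^ 2) s := by
    intro s hs
    rw [uIcc_of_le hAB] at hs
    have hl : HasDerivAt (fun s => k * (s - b)) k s := by
      simpa using ((hasDerivAt_id s).sub_const b).const_mul k
    have := (((hl.cos.const_mul k).div hl.sin (hsin s hs).ne')).neg
    refine this.congr_deriv ?_
    have h3 := Real.sin_sq_add_cos_sq (k * (s - b))
    rw [← neg_div]
    congr 1
    linear_combination k ^ 2 * h3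
  have := intervalIntegral.integral_eq_sub_of_hasDerivAt hder hint
  rw [← ofReal_integral_eq_lintegral_ofReal hint.1
    (Filter.Eventually.of_forall fun s => by positivity),
    ← intervalIntegral.integral_of_le hAB, this, hB]
  simp

/-- This is `x cot x ≤ 1`; it bounds the field `c` by `1/η` at distance at least `η` from its pole.
-/
theorem mul_cos_le_sin {x : ℝ} (h0 : 0 ≤ x) (h1 : x ≤ Real.pi / 2) :
    x * Real.cos x ≤ Real.sin x := by
  rcases h1.lt_or_eq with h | rfl
  · have hc : 0 < Real.cos x := Real.cos_pos_of_mem_Ioo ⟨by linarith [Real.pi_pos], h⟩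
    have := Real.le_tan h0 h
    rwa [Real.tan_eq_sin_div_cos, le_div_iff₀ hc] at this
  · simp

theorem lintegral_indicator_four_cube {t a T : ℝ} (ht : 0 ≤ t) (hta : t ≤ a) (haT : a ≤ T) :
    ∫⁻ τ in Ioc t T, (Iio a).indicator (fun τ => ENNReal.ofReal (4 * τ ^ 3)) τ =
      ENNReal.ofReal (a ^ 4 - t ^ 4) := by
  have hset : Iio a ∩ Ioc t T = Ioo t a := by
    ext τ
    simp only [mem_inter_iff, mem_Iio, mem_Ioc, mem_Ioo]
    exact ⟨fun h => ⟨h.2.1, h.1⟩, fun h => ⟨h.2, h.1, h.2.le.trans haT⟩⟩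
  have hint : IntervalIntegrable (fun τ : ℝ => 4 * τ ^ 3) volume t a :=
    Continuous.intervalIntegrable (by fun_prop) _ _
  rw [lintegral_indicator measurableSet_Iio, Measure.restrict_restrict measurableSet_Iio, hset,
    restrict_Ioo_eq_restrict_Ioc, ← ofReal_integral_eq_lintegral_ofReal hint.1,
    ← intervalIntegral.integral_of_le hta, intervalIntegral.integral_const_mul, integral_pow]
  · congr 1
    push_cast
    ring
  · rw [Filter.EventuallyLE, ae_restrict_iff' measurableSet_Ioc]
    refine Filter.Eventually.of_forall fun τ hτ => ?_
    have : 0 ≤ τ := ht.trans hτ.1.le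
    simp only [Pi.zero_apply]
    positivity

/-- Calibration of the `L⁶` norm above the level `t` by the Dirichlet energy: `w` is the function,
`p` stands for `|w'|`, and `hcov` says that the values of `w` cover `(t, T]`. -/
theorem lintegral_pow_six_le_of_covering {X : Type*} [MeasurableSpace X] (Λ : Measure X)
    [IsFiniteMeasure Λ] {w p : X → ℝ} (hw : Measurable w) (hp : Measurable p) (hw0 : 0 ≤ w)
    (hp0 : 0 ≤ p) {t T : ℝ} (ht : 0 ≤ t) (hT : ∀ x, w x ≤ T)
    (hcov : ∀ g : ℝ → ENNReal, Measurable g →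
      ∫⁻ τ in Ioc t T, g τ ≤ ∫⁻ x, g (w x) * ENNReal.ofReal (p x) ∂Λ)
    (ν : Measure X) [IsFiniteMeasure ν] (hν : ν = Λ.withDensity fun x => ENNReal.ofReal (w x ^ 2))
    {η k : ℝ} (hη : 0 < η)
    (hk : k = Real.pi / (2 * (ν.real univ - ν.real {y | w y ≤ t} + η))) :
    ENNReal.ofReal (k ^ 2) * ∫⁻ x in {x | t < w x}, ENNReal.ofReal (w x ^ 6) ∂Λ ≤
      4 * ∫⁻ x, ENNReal.ofReal (p x ^ 2) ∂Λ + ENNReal.ofReal (t ^ 4 / η) := by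
  set F : ℝ → ℝ := fun a => ν.real {y | w y ≤ a} with hF
  have hFm : Measurable F := measurable_cdf ν w
  have hFmono : Monotone F := fun a b hab =>
    measureReal_mono (fun y (hy : w y ≤ a) => hy.trans hab)
  have hFle : ∀ a, F a ≤ ν.real univ := fun a => measureReal_mono (subset_univ _)
  -- The pole of the cotangent is placed `η` to the left of the masses in use.
  set b : ℝ := F t - η with hb
  have hpos : 0 < ν.real univ - F t + η := by linarith [hFle t]
  have hk0 : 0 < k := by rw [hk]; have := Real.pi_pos; positivity
  have hkend : k * (ν.real univ - b) = Real.pi / 2 := by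
    have h2 : ν.real univ - b = ν.real univ - F t + η := by rw [hb]; ring
    have h3 : k = Real.pi / (2 * (ν.real univ - F t + η)) := hk
    rw [h2, h3]
    field_simp
  -- `c` is the calibrating field and `h = -c' = k² + c²`; the choice of `k` makes `c` vanish at the
  -- total mass.
  set c : ℝ → ℝ := fun s => k * Real.cos (k * (s - b)) / Real.sin (k * (s - b)) with hc
  set h : ℝ → ℝ := fun s => k ^ 2 / Real.sin (k * (s - b)) ^ 2 with hh
  have hcm : Measurable c := by fun_prop
  have hhm : Measurable h := by fun_prop
  have hang : ∀ s ∈ Icc (F t) (ν.real univ),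
      0 < k * (s - b) ∧ k * (s - b) ≤ Real.pi / 2 := by
    intro s hs
    refine ⟨mul_pos hk0 (by linarith [hs.1]), ?_⟩
    rw [← hkend]
    gcongr
    exact hs.2
  have hsin : ∀ s ∈ Icc (F t) (ν.real univ), 0 < Real.sin (k * (s - b)) := fun s hs =>
    Real.sin_pos_of_pos_of_lt_pi (hang s hs).1 (by linarith [(hang s hs).2, Real.pi_pos])
  have hc0 : ∀ s ∈ Icc (F t) (ν.real univ), 0 ≤ c s := fun s hs =>
    div_nonneg (mul_nonneg hk0.le (Real.cos_nonneg_of_mem_Icc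
      ⟨by linarith [(hang s hs).1, Real.pi_pos], (hang s hs).2⟩)) (hsin s hs).le
  have hc1 : ∀ s ∈ Icc (F t) (ν.real univ), c s ≤ 1 / η := by
    intro s hs
    have h1 := mul_cos_le_sin (hang s hs).1.le (hang s hs).2
    have h2 : η ≤ s - b := by linarith [hs.1]
    have h3 : 0 ≤ Real.cos (k * (s - b)) := Real.cos_nonneg_of_mem_Icc
      ⟨by linarith [(hang s hs).1, Real.pi_pos], (hang s hs).2⟩
    rw [hc, div_le_div_iff₀ (hsin s hs) hη, one_mul]
    refine le_trans ?_ h1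
    have : k * Real.cos (k * (s - b)) * η ≤ k * Real.cos (k * (s - b)) * (s - b) := by gcongr
    linarith
  have hhc : ∀ s ∈ Icc (F t) (ν.real univ), h s = k ^ 2 + c s ^ 2 := by
    intro s hs
    have h3 := Real.sin_sq_add_cos_sq (k * (s - b))
    have h4 := (hsin s hs).ne'
    simp only [hh, hc]
    field_simp
    linear_combination - h3
  have hanti : AntitoneOn h (Icc (F t) (ν.real univ)) := by
    intro s hs s' hs' hss
    have : Real.sin (k * (s - b)) ≤ Real.sin (k * (s' - b)) :=
      Real.sin_le_sin_of_le_of_le_pi_div_two (by linarith [(hang s hs).1, Real.pi_pos])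
        (hang s' hs').2 (by gcongr)
    have h1 := hsin s hs
    simp only [hh]
    gcongr
  have htail : ∀ τ, t ≤ τ → ∫⁻ x in {x | τ < w x}, ENNReal.ofReal (h (F (w x))) ∂ν ≤
      ENNReal.ofReal (c (F τ)) := by
    intro τ hτ
    refine (lintegral_comp_cdf_le ν hw τ hhm (fun s => by simp only [hh]; positivity)
      (hanti.mono (Icc_subset_Icc_left (hFmono hτ)))).trans_eq ?_
    exact lintegral_inv_sin_sq hk0 (hang _ ⟨hFmono hτ, hFle τ⟩).1 (hFle τ) hkend
  have hmem : ∀ x, t < w x → F (w x) ∈ Icc (F t) (ν.real univ) := fun x hx =>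
    ⟨hFmono hx.le, hFle _⟩
  set S : Set X := {x | t < w x} with hS
  have hSm : MeasurableSet S := hw measurableSet_Ioi
  -- Write `w⁴ = t⁴ + ∫_t^w 4τ³ dτ`, exchange the integrals and apply `htail` at each level `τ`.
  have hlayer : ∫⁻ x in S, ENNReal.ofReal (h (F (w x)) * w x ^ 4) ∂ν ≤
      ENNReal.ofReal (t ^ 4 / η) +
        ∫⁻ τ in Ioc t T, ENNReal.ofReal (4 * τ ^ 3 * c (F τ)) := by
    have hH : Measurable fun x => ENNReal.ofReal (h (F (w x))) :=
      (hhm.comp (hFm.comp hw)).ennreal_ofReal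
    have hpt : ∀ x ∈ S, ENNReal.ofReal (h (F (w x)) * w x ^ 4) =
        ENNReal.ofReal (t ^ 4) * ENNReal.ofReal (h (F (w x))) +
          ∫⁻ τ in Ioc t T, (Iio (w x)).indicator (fun τ => ENNReal.ofReal (4 * τ ^ 3)) τ *
            ENNReal.ofReal (h (F (w x))) := by
      intro x hx
      have hx' : t < w x := hx
      have h4 : t ^ 4 ≤ w x ^ 4 := by gcongr
      rw [lintegral_mul_const _ (Measurable.indicator (by fun_prop) measurableSet_Iio),
        lintegral_indicator_four_cube ht hx'.le (hT x), ← add_mul,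
        ← ENNReal.ofReal_add (by positivity) (by linarith),
        ← ENNReal.ofReal_mul (by linarith [pow_nonneg ht 4])]
      congr 1
      ring
    rw [setLIntegral_congr_fun hSm hpt, lintegral_add_left (hH.const_mul _),
      lintegral_const_mul _ hH]
    refine add_le_add ?_ ?_
    · refine (mul_le_mul_right (htail t le_rfl) _).trans ?_
      rw [← ENNReal.ofReal_mul (by positivity)]
      refine ENNReal.ofReal_le_ofReal ?_
      rw [div_eq_mul_one_div]
      exact mul_le_mul_of_nonneg_left (hc1 _ ⟨le_rfl, hFle t⟩) (by positivity)
    · rw [lintegral_lintegral_swap]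
      · refine setLIntegral_mono' measurableSet_Ioc fun τ hτ => ?_
        have hτ0 : 0 ≤ τ := ht.trans hτ.1.le
        have e1 : ∀ x, (Iio (w x)).indicator (fun τ => ENNReal.ofReal (4 * τ ^ 3)) τ *
            ENNReal.ofReal (h (F (w x))) = {x | τ < w x}.indicator
              (fun x => ENNReal.ofReal (4 * τ ^ 3) * ENNReal.ofReal (h (F (w x)))) x := by
          intro x
          by_cases hx : τ < w x <;> simp [indicator, hx]
        have e2 : {x | τ < w x} ∩ S = {x | τ < w x} :=
          inter_eq_left.2 fun x (hx : τ < w x) => hτ.1.trans hx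
        have hτm : MeasurableSet {x | τ < w x} := hw measurableSet_Ioi
        simp only [e1]
        rw [lintegral_indicator hτm, Measure.restrict_restrict hτm, e2,
          lintegral_const_mul _ hH, ENNReal.ofReal_mul (p := 4 * τ ^ 3) (by positivity)]
        exact mul_le_mul_right (htail τ hτ.1.le) _
      · refine Measurable.aemeasurable ?_
        refine Measurable.mul ?_ (hH.comp measurable_fst)
        have : Measurable ({q : X × ℝ | q.2 < w q.1}.indicator
            fun q => ENNReal.ofReal (4 * q.2 ^ 3)) :=
          Measurable.indicator (by fun_prop)
            (measurableSet_lt measurable_snd (hw.comp measurable_fst))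
        exact this
  have hcFm : Measurable fun x => c (F (w x)) := hcm.comp (hFm.comp hw)
  -- Young's inequality from `(2p - c w³)² ≥ 0`; its term `c² w⁶` is exactly the one produced by
  -- `hsplit`.
  have hcal : ∫⁻ x in S, ENNReal.ofReal (4 * w x ^ 3 * c (F (w x))) * ENNReal.ofReal (p x) ∂Λ ≤
      4 * ∫⁻ x, ENNReal.ofReal (p x ^ 2) ∂Λ +
        ∫⁻ x in S, ENNReal.ofReal (c (F (w x)) ^ 2 * w x ^ 6) ∂Λ := by
    have : ∫⁻ x in S, ENNReal.ofReal (4 * w x ^ 3 * c (F (w x))) * ENNReal.ofReal (p x) ∂Λ ≤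
        ∫⁻ x in S, (4 * ENNReal.ofReal (p x ^ 2) +
          ENNReal.ofReal (c (F (w x)) ^ 2 * w x ^ 6)) ∂Λ := by
      refine setLIntegral_mono' hSm fun x hx => ?_
      have h1 := hw0 x
      have h2 := hp0 x
      have h3 := hc0 _ (hmem x hx)
      simp only [Pi.zero_apply] at h1 h2
      have h4 : (4 : ENNReal) = ENNReal.ofReal 4 := by simp
      rw [h4, ← ENNReal.ofReal_mul (by positivity), ← ENNReal.ofReal_mul (by positivity),
        ← ENNReal.ofReal_add (by positivity) (by positivity)]
      refine ENNReal.ofReal_le_ofReal ?_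
      linarith [sq_nonneg (2 * p x - c (F (w x)) * w x ^ 3)]
    refine this.trans ?_
    rw [lintegral_add_left (by fun_prop), lintegral_const_mul _ (by fun_prop)]
    gcongr
    exact Measure.restrict_le_self
  have hcov' : ∫⁻ τ in Ioc t T, ENNReal.ofReal (4 * τ ^ 3 * c (F τ)) ≤
      ∫⁻ x in S, ENNReal.ofReal (4 * w x ^ 3 * c (F (w x))) * ENNReal.ofReal (p x) ∂Λ := by
    have hg : Measurable ((Ioi t).indicator fun τ => ENNReal.ofReal (4 * τ ^ 3 * c (F τ))) := by
      refine Measurable.indicator ?_ measurableSet_Ioi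
      have := hcm.comp hFm
      exact ((measurable_id.pow_const 3).const_mul 4 |>.mul this).ennreal_ofReal
    have e1 : ∫⁻ τ in Ioc t T, ENNReal.ofReal (4 * τ ^ 3 * c (F τ)) =
        ∫⁻ τ in Ioc t T, (Ioi t).indicator (fun τ => ENNReal.ofReal (4 * τ ^ 3 * c (F τ))) τ :=
      setLIntegral_congr_fun measurableSet_Ioc fun τ hτ => by
        rw [indicator_of_mem (show τ ∈ Ioi t from hτ.1)]
    rw [e1, ← lintegral_indicator hSm]
    refine (hcov _ hg).trans_eq (lintegral_congr fun x => ?_)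
    by_cases hx : t < w x <;> simp [indicator, hx, hS]
  have hsplit : ∫⁻ x in S, ENNReal.ofReal (h (F (w x)) * w x ^ 4) ∂ν =
      ENNReal.ofReal (k ^ 2) * ∫⁻ x in S, ENNReal.ofReal (w x ^ 6) ∂Λ +
        ∫⁻ x in S, ENNReal.ofReal (c (F (w x)) ^ 2 * w x ^ 6) ∂Λ := by
    have hH : Measurable fun x => ENNReal.ofReal (h (F (w x)) * w x ^ 4) :=
      ((hhm.comp (hFm.comp hw)).mul (hw.pow_const 4)).ennreal_ofReal
    rw [hν, restrict_withDensity hSm, lintegral_withDensity_eq_lintegral_mul _ (by fun_prop) hH,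
      ← lintegral_const_mul _ (by fun_prop), ← lintegral_add_left (by fun_prop)]
    refine setLIntegral_congr_fun hSm fun x hx => ?_
    simp only [Pi.mul_apply]
    rw [← ENNReal.ofReal_mul (by positivity), ← ENNReal.ofReal_mul (by positivity),
      ← ENNReal.ofReal_add (by positivity) (by positivity)]
    have := hhc _ (hmem x hx)
    rw [this]
    congr 1
    ring
  -- Finiteness permits cancelling this term in `ENNReal`.
  have hfin : ∫⁻ x in S, ENNReal.ofReal (c (F (w x)) ^ 2 * w x ^ 6) ∂Λ ≠ ⊤ := by
    refine ne_of_lt ?_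
    refine (setLIntegral_mono' (g := fun _ => ENNReal.ofReal ((1 / η) ^ 2 * T ^ 6)) hSm
      fun x hx => ENNReal.ofReal_le_ofReal ?_).trans_lt ?_
    · have h1 := hw0 x
      have h2 := hT x
      have h3 := hc0 _ (hmem x hx)
      have h4 := hc1 _ (hmem x hx)
      simp only [Pi.zero_apply] at h1
      gcongr
    · rw [setLIntegral_const]
      exact ENNReal.mul_lt_top ENNReal.ofReal_lt_top (measure_lt_top _ _)
  refine (ENNReal.add_le_add_iff_right hfin).1 ?_
  rw [← hsplit]
  refine hlayer.trans ?_
  refine (add_le_add_right (hcov'.trans hcal) _).trans_eq ?_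
  ring

/-! ### Choice of a level with little mass below it. -/

theorem lintegral_rpow_neg_three_quarters_le {ε A : ℝ} (hε : 0 < ε) (hA : 0 ≤ A) :
    ∫⁻ s in Ioc 0 A, ENNReal.ofReal ((max s 0 + ε) ^ (-(3 / 4) : ℝ)) ≤
      ENNReal.ofReal (4 * (A + ε) ^ (1 / 4 : ℝ)) := by
  have hder : ∀ s ∈ uIcc 0 A, HasDerivAt (fun s => 4 * (s + ε) ^ (1 / 4 : ℝ))
      ((s + ε) ^ (-(3 / 4) : ℝ)) s := by
    intro s hs
    rw [uIcc_of_le hA] at hs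
    have h1 : s + ε ≠ 0 := by linarith [hs.1]
    have := (((hasDerivAt_id s).add_const ε).rpow_const (p := 1 / 4) (Or.inl h1)).const_mul 4
    refine this.congr_deriv ?_
    norm_num
    ring
  have hcont : ContinuousOn (fun s => (s + ε) ^ (-(3 / 4) : ℝ)) (Icc 0 A) :=
    ContinuousOn.rpow_const (by fun_prop) fun s hs => Or.inl (by linarith [hs.1])
  have hint := hcont.intervalIntegrable_of_Icc (μ := volume) hA
  have := intervalIntegral.integral_eq_sub_of_hasDerivAt hder hint
  rw [intervalIntegral.integral_of_le hA] at this
  rw [setLIntegral_congr_fun (g := fun s => ENNReal.ofReal ((s + ε) ^ (-(3 / 4) : ℝ)))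
    measurableSet_Ioc fun s hs => by simp only [max_eq_left hs.1.le],
    ← ofReal_integral_eq_lintegral_ofReal hint.1, this]
  · refine ENNReal.ofReal_le_ofReal ?_
    have : 0 ≤ 4 * (0 + ε) ^ (1 / 4 : ℝ) := by positivity
    linarith
  · rw [Filter.EventuallyLE, ae_restrict_iff' measurableSet_Ioc]
    refine Filter.Eventually.of_forall fun s hs => ?_
    exact Real.rpow_nonneg (by linarith [hs.1]) _

/-- A positive function on a space of total measure `L` has a level whose square is controlled by
the mass below it. -/
theorem exists_level_sq_le {X : Type*} [MeasurableSpace X] (Λ : Measure X)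
    [IsFiniteMeasure Λ] {w : X → ℝ} (hw : Measurable w) {m : ℝ} (hm : 0 < m) (hmw : ∀ x, m ≤ w x)
    (ν : Measure X) [IsFiniteMeasure ν] (hν : ν = Λ.withDensity fun x => ENNReal.ofReal (w x ^ 2))
    {μ₀ L : ℝ} (hμ : ν.real univ ≤ μ₀) (hL : 0 < L) (hΛ : Λ.real univ = L) :
    ∃ x, w x ^ 2 ≤ 16 * (μ₀ + 1) / L * ν.real {y | w y ≤ w x} ^ (3 / 4 : ℝ) := by
  -- Otherwise `w² > C F(w)^(3/4)` everywhere, so the total length `∫ w⁻² dν` is at most about `C⁻¹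
  -- ∫_0^μ s^(-3/4) ds = 4 μ^(1/4) / C`, which is less than `L`.
  by_contra! hcon
  have hμ0 : 0 ≤ ν.real univ := measureReal_nonneg
  set C : ℝ := 16 * (μ₀ + 1) / L with hC
  have hCpos : 0 < C := by have : 0 ≤ μ₀ := hμ0.trans hμ; positivity
  -- The shift by `ε` keeps the power antitone up to `s = 0`, where the unshifted one takes the
  -- default value `0`; `w ≥ m > 0` absorbs it at the cost of a factor `2`.
  obtain ⟨ε, hε, hε1, hεm⟩ : ∃ ε : ℝ, 0 < ε ∧ ε ≤ 1 ∧ C * ε ^ (3 / 4 : ℝ) ≤ m ^ 2 := by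
    refine ⟨min 1 ((m ^ 2 / C) ^ (4 / 3 : ℝ)), by positivity, min_le_left _ _, ?_⟩
    have : (min 1 ((m ^ 2 / C) ^ (4 / 3 : ℝ))) ^ (3 / 4 : ℝ) ≤ m ^ 2 / C := by
      calc _ ≤ ((m ^ 2 / C) ^ (4 / 3 : ℝ)) ^ (3 / 4 : ℝ) :=
            Real.rpow_le_rpow (by positivity) (min_le_right _ _) (by norm_num)
        _ = m ^ 2 / C := by rw [← Real.rpow_mul (by positivity)]; norm_num
    rwa [le_div_iff₀' hCpos] at this
  set F : ℝ → ℝ := fun a => ν.real {y | w y ≤ a} with hF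
  have hF0 : ∀ a, 0 ≤ F a := fun a => measureReal_nonneg
  set h : ℝ → ℝ := fun s => (max s 0 + ε) ^ (-(3 / 4) : ℝ) with hh
  have hhm : Measurable h := by fun_prop
  have hh0 : 0 ≤ h := fun s => Real.rpow_nonneg (by positivity) _
  have hpt : ∀ x, 1 ≤ 2 / C * (w x ^ 2 * h (F (w x))) := by
    intro x
    have h1 : C * F (w x) ^ (3 / 4 : ℝ) ≤ w x ^ 2 := (hcon x).le
    have h2 : C * ε ^ (3 / 4 : ℝ) ≤ w x ^ 2 :=
      hεm.trans (by have := hmw x; gcongr)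
    have h3 : (F (w x) + ε) ^ (3 / 4 : ℝ) ≤ F (w x) ^ (3 / 4 : ℝ) + ε ^ (3 / 4 : ℝ) :=
      Real.rpow_add_le_add_rpow (hF0 _) hε.le (by norm_num) (by norm_num)
    have h4 : 0 < (F (w x) + ε) ^ (3 / 4 : ℝ) := Real.rpow_pos_of_pos (by linarith [hF0 (w x)]) _
    have h5 : h (F (w x)) = ((F (w x) + ε) ^ (3 / 4 : ℝ))⁻¹ := by
      simp only [hh]
      rw [max_eq_left (hF0 _), Real.rpow_neg (by linarith [hF0 (w x)])]
    rw [h5, ← div_eq_mul_inv, ← mul_div_assoc, le_div_iff₀ h4, div_mul_eq_mul_div,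
      le_div_iff₀ hCpos]
    nlinarith
  -- The level `-1` lies below all values of `w`, so the comparison starts from mass `0`.
  have hempty : {y | w y ≤ -1} = ∅ := by
    ext y
    simp only [mem_ofPred_eq, mem_empty_iff_false, iff_false, not_le]
    linarith [hmw y]
  have huniv : {y | -1 < w y} = univ := by
    ext y
    simp only [mem_ofPred_eq, mem_univ, iff_true]
    linarith [hmw y]
  have hanti : AntitoneOn h (Icc (ν.real {y | w y ≤ -1}) (ν.real univ)) := by
    intro s _ s' _ hs
    exact Real.rpow_le_rpow_of_nonpos (by positivity) (by gcongr) (by norm_num)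
  have hmain := lintegral_comp_cdf_le ν hw (-1) hhm hh0 hanti
  rw [hempty, huniv, Measure.restrict_univ, measureReal_empty] at hmain
  have hFm : Measurable F := measurable_cdf ν w
  have hΛle : Λ univ ≤ ENNReal.ofReal (2 / C) *
      ENNReal.ofReal (4 * (ν.real univ + ε) ^ (1 / 4 : ℝ)) := by
    calc Λ univ = ∫⁻ _, 1 ∂Λ := by simp
      _ ≤ ∫⁻ x, ENNReal.ofReal (2 / C) *
          (ENNReal.ofReal (w x ^ 2) * ENNReal.ofReal (h (F (w x)))) ∂Λ := by
        refine lintegral_mono fun x => ?_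
        rw [← ENNReal.ofReal_mul (by positivity), ← ENNReal.ofReal_mul (by positivity),
          ← ENNReal.ofReal_one]
        exact ENNReal.ofReal_le_ofReal (hpt x)
      _ = ENNReal.ofReal (2 / C) * ∫⁻ x, ENNReal.ofReal (h (F (w x))) ∂ν := by
        have hH : Measurable fun x => ENNReal.ofReal (h (F (w x))) :=
          (hhm.comp (hFm.comp hw)).ennreal_ofReal
        rw [lintegral_const_mul' _ _ ENNReal.ofReal_ne_top]
        congr 1
        conv_rhs => rw [hν]
        rw [lintegral_withDensity_eq_lintegral_mul _ (by fun_prop) hH]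
        rfl
      _ ≤ _ := by
        gcongr
        exact hmain.trans (lintegral_rpow_neg_three_quarters_le hε hμ0)
  have hreal : L ≤ 2 / C * (4 * (ν.real univ + ε) ^ (1 / 4 : ℝ)) := by
    rw [← hΛ, measureReal_def]
    refine ENNReal.toReal_le_of_le_ofReal (by positivity) ?_
    rwa [ENNReal.ofReal_mul (by positivity)]
  have hroot : (ν.real univ + ε) ^ (1 / 4 : ℝ) ≤ μ₀ + 1 := by
    calc _ ≤ (μ₀ + 1) ^ (1 / 4 : ℝ) := by gcongr
      _ ≤ (μ₀ + 1) ^ (1 : ℝ) :=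
        Real.rpow_le_rpow_of_exponent_le (by linarith) (by norm_num)
      _ = μ₀ + 1 := Real.rpow_one _
  have : 2 / C * (4 * (ν.real univ + ε) ^ (1 / 4 : ℝ)) ≤ 2 / C * (4 * (μ₀ + 1)) := by gcongr
  have h2 : 2 / C * (4 * (μ₀ + 1)) = L / 2 := by
    rw [hC]
    have : μ₀ + 1 ≠ 0 := by linarith
    field_simp
    norm_num
  linarith

/-! ### The inequality on an abstract measure space. -/

/-- Calibration handles `{w > t}`; on `{w ≤ t}` the bound `w⁶ ≤ t⁴ w²` suffices. -/
theorem pow_six_le_of_covering {X : Type*} [MeasurableSpace X] (Λ : Measure X)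
    [IsFiniteMeasure Λ] {w p : X → ℝ} (hw : Measurable w) (hp : Measurable p) (hw0 : 0 ≤ w)
    (hp0 : 0 ≤ p) {t T : ℝ} (ht : 0 ≤ t) (hT : ∀ x, w x ≤ T)
    (hcov : ∀ g : ℝ → ENNReal, Measurable g →
      ∫⁻ τ in Ioc t T, g τ ≤ ∫⁻ x, g (w x) * ENNReal.ofReal (p x) ∂Λ)
    (ν : Measure X) [IsFiniteMeasure ν] (hν : ν = Λ.withDensity fun x => ENNReal.ofReal (w x ^ 2))
    {D K : ℝ} (hD0 : 0 ≤ D) (hD : ∫⁻ x, ENNReal.ofReal (p x ^ 2) ∂Λ ≤ ENNReal.ofReal D)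
    (hK : ENNReal.ofReal K ≤ ∫⁻ x, ENNReal.ofReal (w x ^ 6) ∂Λ) {η : ℝ} (hη : 0 < η) :
    K ≤ 4 / Real.pi ^ 2 * (ν.real univ - ν.real {y | w y ≤ t} + η) ^ 2 * (4 * D + t ^ 4 / η) +
      t ^ 4 * ν.real {y | w y ≤ t} := by
  set M := ν.real {y | w y ≤ t} with hM
  have hMle : M ≤ ν.real univ := measureReal_mono (subset_univ _)
  have hM0 : 0 ≤ M := measureReal_nonneg
  have hpos : 0 < ν.real univ - M + η := by linarith
  obtain ⟨k, hk⟩ : ∃ k, k = Real.pi / (2 * (ν.real univ - M + η)) := ⟨_, rfl⟩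
  have hk0 : 0 < k := by rw [hk]; have := Real.pi_pos; positivity
  have h1 := lintegral_pow_six_le_of_covering Λ hw hp hw0 hp0 ht hT hcov ν hν hη hk
  have hSm : MeasurableSet {x | w x ≤ t} := hw measurableSet_Iic
  have hcompl : {x | w x ≤ t}ᶜ = {x | t < w x} := by ext; simp
  have hup : ∫⁻ x in {x | t < w x}, ENNReal.ofReal (w x ^ 6) ∂Λ ≤
      ENNReal.ofReal (1 / k ^ 2 * (4 * D + t ^ 4 / η)) := by
    have h2 : 4 * ∫⁻ x, ENNReal.ofReal (p x ^ 2) ∂Λ + ENNReal.ofReal (t ^ 4 / η) ≤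
        ENNReal.ofReal (4 * D + t ^ 4 / η) := by
      rw [ENNReal.ofReal_add (by positivity) (by positivity), ENNReal.ofReal_mul (by norm_num)]
      gcongr
      simp
    have h3 := mul_le_mul_right (h1.trans h2) (ENNReal.ofReal (1 / k ^ 2))
    rwa [← mul_assoc, ← ENNReal.ofReal_mul (by positivity), one_div_mul_cancel (by positivity),
      ENNReal.ofReal_one, one_mul, ← ENNReal.ofReal_mul (by positivity)] at h3
  have hlow : ∫⁻ x in {x | w x ≤ t}, ENNReal.ofReal (w x ^ 6) ∂Λ ≤ ENNReal.ofReal (t ^ 4 * M) := by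
    calc _ ≤ ∫⁻ x in {x | w x ≤ t}, ENNReal.ofReal (t ^ 4) * ENNReal.ofReal (w x ^ 2) ∂Λ := by
          refine setLIntegral_mono' hSm fun x (hx : w x ≤ t) => ?_
          rw [← ENNReal.ofReal_mul (by positivity)]
          refine ENNReal.ofReal_le_ofReal ?_
          have : 0 ≤ w x := hw0 x
          calc w x ^ 6 = w x ^ 4 * w x ^ 2 := by ring
            _ ≤ _ := by gcongr
      _ = ENNReal.ofReal (t ^ 4) * ν {x | w x ≤ t} := by
          rw [lintegral_const_mul _ (by fun_prop), hν, withDensity_apply _ hSm]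
      _ = _ := by
          rw [ENNReal.ofReal_mul (by positivity), hM, ofReal_measureReal]
  have hk2 : 1 / k ^ 2 = 4 / Real.pi ^ 2 * (ν.real univ - M + η) ^ 2 := by
    rw [hk]
    have := Real.pi_pos
    field_simp
    norm_num
  rw [← hk2]
  refine (ENNReal.ofReal_le_ofReal_iff (by positivity)).1 (hK.trans ?_)
  rw [← lintegral_add_compl _ hSm, hcompl, ENNReal.ofReal_add (by positivity) (by positivity),
    add_comm]
  exact add_le_add hup hlow

/-- The modified Gagliardo–Nirenberg inequality for a function on a measure space whose values
cover the interval between its bounds. -/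
theorem exists_pow_six_le_of_covering {L μ₀ : ℝ} (hL : 0 < L) (hμ₀ : 0 ≤ μ₀) :
    ∃ C, 0 < C ∧ ∀ {X : Type*} [MeasurableSpace X] (Λ : Measure X) [IsFiniteMeasure Λ]
      {w p : X → ℝ}, Λ.real univ = L → Measurable w → Measurable p → 0 ≤ w → 0 ≤ p →
      ∀ {m T : ℝ}, 0 ≤ m → (∀ x, m ≤ w x) → (∀ x, w x ≤ T) →
      (∀ g : ℝ → ENNReal, Measurable g →
        ∫⁻ τ in Ioc m T, g τ ≤ ∫⁻ x, g (w x) * ENNReal.ofReal (p x) ∂Λ) →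
      ∀ {μ D K : ℝ}, 0 ≤ D → 0 ≤ μ → μ ≤ μ₀ →
      ∫⁻ x, ENNReal.ofReal (p x ^ 2) ∂Λ ≤ ENNReal.ofReal D →
      ENNReal.ofReal K ≤ ∫⁻ x, ENNReal.ofReal (w x ^ 6) ∂Λ →
      ∫⁻ x, ENNReal.ofReal (w x ^ 2) ∂Λ = ENNReal.ofReal μ →
      ∃ θ ∈ Icc 0 μ, K ≤ 16 / Real.pi ^ 2 * (μ - θ) ^ 2 * D + C * θ ^ (1 / 2 : ℝ) := by
  set A : ℝ := 16 * (μ₀ + 1) / L with hA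
  have hA0 : 0 < A := by positivity
  refine ⟨16 * A ^ 2 * (μ₀ + 1) ^ 2, by positivity, ?_⟩
  intro X _ Λ _ w p hΛ hw hp hw0 hp0 m T hm hmw hT hcov μ D K hD0 hμ0 hμ hD hK hmass
  set ν : Measure X := Λ.withDensity fun x => ENNReal.ofReal (w x ^ 2) with hν
  have hνuniv : ν univ = ENNReal.ofReal μ := by
    rw [hν, withDensity_apply _ MeasurableSet.univ, Measure.restrict_univ, hmass]
  have : IsFiniteMeasure ν := ⟨by rw [hνuniv]; exact ENNReal.ofReal_lt_top⟩
  have hνr : ν.real univ = μ := by rw [measureReal_def, hνuniv, ENNReal.toReal_ofReal hμ0]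
  have hmain : ∀ t, m ≤ t → ∀ η, 0 < η →
      K ≤ 4 / Real.pi ^ 2 * (μ - ν.real {y | w y ≤ t} + η) ^ 2 * (4 * D + t ^ 4 / η) +
        t ^ 4 * ν.real {y | w y ≤ t} := by
    intro t ht η hη
    rw [← hνr]
    exact pow_six_le_of_covering Λ hw hp hw0 hp0 (hm.trans ht) hT
      (fun g hg => (lintegral_mono_set (Ioc_subset_Ioc_left ht)).trans (hcov g hg))
      ν hν hD0 hD hK hη
  have hpi := Real.pi_pos
  rcases hm.eq_or_lt with rfl | hm
  -- When the lower bound is `0`, take `η = t²` and let `t → 0`: every error term vanishes.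
  · refine ⟨0, ⟨le_rfl, hμ0⟩, ?_⟩
    have hbound : ∀ t : ℝ, 0 < t →
        K ≤ 4 / Real.pi ^ 2 * (μ + t ^ 2) ^ 2 * (4 * D + t ^ 2) + t ^ 4 * μ := by
      intro t ht
      refine (hmain t ht.le (t ^ 2) (by positivity)).trans ?_
      have h1 : t ^ 4 / t ^ 2 = t ^ 2 := by field_simp
      have h2 : ν.real {y | w y ≤ t} ≤ μ := hνr ▸ measureReal_mono (subset_univ _)
      have h3 : 0 ≤ ν.real {y | w y ≤ t} := measureReal_nonneg
      have h4 : 0 ≤ μ - ν.real {y | w y ≤ t} + t ^ 2 := by nlinarith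
      rw [h1]
      gcongr
      linarith
    have hlim : Filter.Tendsto
        (fun t : ℝ => 4 / Real.pi ^ 2 * (μ + t ^ 2) ^ 2 * (4 * D + t ^ 2) + t ^ 4 * μ)
        (nhdsWithin 0 (Ioi 0))
        (nhds (4 / Real.pi ^ 2 * (μ + 0 ^ 2) ^ 2 * (4 * D + 0 ^ 2) + 0 ^ 4 * μ)) :=
      (Continuous.tendsto (by fun_prop) 0).mono_left nhdsWithin_le_nhds
    have := ge_of_tendsto hlim (by
      filter_upwards [self_mem_nhdsWithin] with t ht using hbound t ht)
    refine this.trans_eq ?_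
    rw [Real.zero_rpow (by norm_num)]
    ring
  · obtain ⟨x, hx⟩ := exists_level_sq_le Λ hw hm hmw ν hν (hνr.trans_le hμ) hL hΛ
    rw [← hA] at hx
    set t := w x with ht
    have htm : m ≤ t := hmw x
    have ht0 : 0 < t := hm.trans_le htm
    set M := ν.real {y | w y ≤ t} with hM
    have hM0 : 0 ≤ M := measureReal_nonneg
    have hMμ : M ≤ μ := hνr ▸ measureReal_mono (subset_univ _)
    have hMpos : 0 < M := by
      rcases hM0.eq_or_lt with h | h
      · rw [← h, Real.zero_rpow (by norm_num), mul_zero] at hx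
        nlinarith
      · exact h
    -- With `η = θ = M / 2`, the mass factor `μ - M + η` is exactly `μ - θ`, and `t⁴/η` is of order
    -- `M^(3/2) / M`.
    refine ⟨M / 2, ⟨by positivity, by linarith⟩, ?_⟩
    have h0 := hmain t htm (M / 2) (by positivity)
    have e1 : μ - M + M / 2 = μ - M / 2 := by ring
    rw [e1] at h0
    refine h0.trans ?_
    set r := M ^ (1 / 2 : ℝ) with hr
    have hr0 : 0 < r := by positivity
    have ht4 : t ^ 4 ≤ A ^ 2 * (M * r) := by
      have h1 : (t ^ 2) ^ 2 ≤ (A * M ^ (3 / 4 : ℝ)) ^ 2 := by gcongr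
      have h2 : (M ^ (3 / 4 : ℝ)) ^ 2 = M * r := by
        rw [hr, ← Real.rpow_natCast, ← Real.rpow_mul hM0]
        nth_rewrite 2 [← Real.rpow_one M]
        rw [← Real.rpow_add hMpos]
        norm_num
      calc t ^ 4 = (t ^ 2) ^ 2 := by ring
        _ ≤ _ := h1
        _ = _ := by rw [mul_pow, h2]
    have hdiv : t ^ 4 / (M / 2) ≤ 2 * A ^ 2 * r := by
      rw [div_le_iff₀ (by positivity)]
      linarith
    have hsmall : t ^ 4 * M ≤ A ^ 2 * μ₀ ^ 2 * r := by
      have : M * M ≤ μ₀ ^ 2 := by nlinarith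
      calc t ^ 4 * M ≤ A ^ 2 * (M * r) * M := by gcongr
        _ = A ^ 2 * (M * M) * r := by ring
        _ ≤ _ := by gcongr
    have hhalf : r ≤ 2 * (M / 2) ^ (1 / 2 : ℝ) := by
      have h1 : r = 2 ^ (1 / 2 : ℝ) * (M / 2) ^ (1 / 2 : ℝ) := by
        rw [← Real.mul_rpow (by norm_num) (by positivity), hr]
        congr 1
        ring
      have h2 : (2 : ℝ) ^ (1 / 2 : ℝ) ≤ 2 := by
        conv_rhs => rw [← Real.rpow_one 2]
        exact Real.rpow_le_rpow_of_exponent_le (by norm_num) (by norm_num)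
      rw [h1]
      gcongr
    have hpi2 : 4 / Real.pi ^ 2 ≤ 1 := by
      rw [div_le_one (by positivity)]
      nlinarith [Real.pi_gt_three]
    have hsq : (μ - M / 2) ^ 2 ≤ μ₀ ^ 2 := by
      have : 0 ≤ μ - M / 2 := by linarith
      gcongr
      linarith
    calc 4 / Real.pi ^ 2 * (μ - M / 2) ^ 2 * (4 * D + t ^ 4 / (M / 2)) + t ^ 4 * M
        = 16 / Real.pi ^ 2 * (μ - M / 2) ^ 2 * D +
          (4 / Real.pi ^ 2 * (μ - M / 2) ^ 2 * (t ^ 4 / (M / 2)) + t ^ 4 * M) := by ring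
      _ ≤ 16 / Real.pi ^ 2 * (μ - M / 2) ^ 2 * D +
          (1 * μ₀ ^ 2 * (2 * A ^ 2 * r) + A ^ 2 * μ₀ ^ 2 * r) := by gcongr
      _ = 16 / Real.pi ^ 2 * (μ - M / 2) ^ 2 * D + 3 * A ^ 2 * μ₀ ^ 2 * r := by ring
      _ ≤ 16 / Real.pi ^ 2 * (μ - M / 2) ^ 2 * D +
          8 * A ^ 2 * (μ₀ + 1) ^ 2 * (2 * (M / 2) ^ (1 / 2 : ℝ)) := by
          gcongr
          · norm_num
          · linarith
      _ = _ := by ring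

/-! ### Measures of images on an interval. -/

/-- The distribution function of a finite atomless measure pushes it forward to the Lebesgue
measure. -/
theorem map_measureReal_Iic {κ : Measure ℝ} [IsFiniteMeasure κ] [NullSingletonClass κ] {l : ℝ}
    (hκ : κ (Ioo 0 l)ᶜ = 0) :
    κ.map (fun x => κ.real (Iic x)) = volume.restrict (Icc 0 (κ.real univ)) := by
  set N := κ.real univ with hN
  set P : ℝ → ℝ := fun x => κ.real (Iic x) with hP
  have hPm : Measurable P := measurable_cdf κ id
  have hN0 : 0 ≤ N := measureReal_nonneg
  have hae : ∀ᵐ x ∂κ, x ∈ Ioo 0 l := by rwa [ae_iff]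
  have hPuniv : κ univ = ENNReal.ofReal N := by rw [hN, ofReal_measureReal]
  have hup : ∀ s, κ {x | P x ≤ s} ≤ volume (Iic s ∩ Icc 0 N) := by
    intro s
    have h1 := measure_cdf_mem_le κ (f := id) measurable_id (-1) (Iic s)
      (fun a ha b hb => hb.2.trans ha)
    have h2 : κ.real {y | id y ≤ (-1 : ℝ)} = 0 := by
      rw [measureReal_eq_zero_iff]
      refine measure_mono_null (fun y hy => ?_) hκ
      intro hy'
      have : y ≤ -1 := hy
      linarith [hy'.1]
    rw [h2] at h1
    calc κ {x | P x ≤ s} ≤ κ {x | -1 < id x ∧ κ.real {y | id y ≤ id x} ∈ Iic s} := by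
          refine measure_mono_ae ?_
          filter_upwards [hae] with x hx hxs
          exact ⟨show -1 < x by linarith [hx.1], hxs⟩
      _ ≤ _ := h1
      _ ≤ _ := measure_mono (inter_subset_inter_right _ Ioc_subset_Icc_self)
  have hlow : ∀ s, volume (Iic s ∩ Icc 0 N) ≤ κ {x | P x ≤ s} := by
    intro s
    rcases lt_or_ge s 0 with hs | hs
    · have : Iic s ∩ Icc 0 N = ∅ := by
        ext r
        simp only [mem_inter_iff, mem_Iic, mem_Icc, mem_empty_iff_false, iff_false]
        intro hr
        linarith [hr.1, hr.2.1]
      simp [this]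
    -- The reflected comparison bounds `κ {P > s}`, because atomlessness gives `κ [x, ∞) = N - P x`;
    -- complementing yields the reverse inequality.
    have h1 := measure_cdf_mem_le κ (f := fun x => -x) measurable_neg (-l - 1) (Iic (N - s))
      (fun a ha b hb => hb.2.trans ha)
    have hIci : ∀ x, κ.real {y | -y ≤ -x} = N - P x := by
      intro x
      have e : {y : ℝ | -y ≤ -x} = Ici x := by ext y; simp
      have e2 : (Iic x)ᶜ = Ioi x := compl_Iic
      rw [e, measureReal_congr Ioi_ae_eq_Ici.symm, ← e2, measureReal_compl measurableSet_Iic]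
    have h2 : κ.real {y | -y ≤ -l - 1} = 0 := by
      rw [measureReal_eq_zero_iff]
      refine measure_mono_null (fun y hy => ?_) hκ
      intro hy'
      have : -y ≤ -l - 1 := hy
      linarith [hy'.2]
    rw [h2] at h1
    have h3 : κ {x | P x ≤ s}ᶜ ≤ ENNReal.ofReal (N - s) := by
      calc κ {x | P x ≤ s}ᶜ ≤ κ {x | -l - 1 < -x ∧ κ.real {y | -y ≤ -x} ∈ Iic (N - s)} := by
            refine measure_mono_ae ?_
            filter_upwards [hae] with x hx hxs
            have hxs' : s < P x := not_le.1 hxs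
            refine ⟨by linarith [hx.2], ?_⟩
            rw [hIci, mem_Iic]
            linarith
        _ ≤ _ := h1
        _ ≤ volume (Ioc 0 (N - s)) := measure_mono fun r hr => ⟨hr.2.1, hr.1⟩
        _ = _ := by rw [Real.volume_Ioc, sub_zero]
    have hms : MeasurableSet {x | P x ≤ s} := hPm measurableSet_Iic
    have h4 : ENNReal.ofReal N ≤ κ {x | P x ≤ s} + ENNReal.ofReal (N - s) := by
      rw [← hPuniv, ← measure_add_measure_compl hms]
      gcongr
    rcases le_total N s with hNs | hNs
    · rw [ENNReal.ofReal_of_nonpos (sub_nonpos.2 hNs), add_zero] at h4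
      refine (measure_mono inter_subset_right).trans ?_
      rwa [Real.volume_Icc, sub_zero]
    · have e : Iic s ∩ Icc 0 N ⊆ Icc 0 s := fun r hr => ⟨hr.2.1, hr.1⟩
      refine (measure_mono e).trans ?_
      rw [Real.volume_Icc, sub_zero]
      have e2 : ENNReal.ofReal N = ENNReal.ofReal s + ENNReal.ofReal (N - s) := by
        rw [← ENNReal.ofReal_add hs (by linarith)]
        congr 1
        ring
      rw [e2] at h4
      exact (ENNReal.add_le_add_iff_right ENNReal.ofReal_ne_top).1 h4
  have : IsFiniteMeasure (κ.map P) := Measure.isFiniteMeasure_map κ P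
  refine Measure.ext_of_Iic _ _ fun s => ?_
  rw [Measure.map_apply hPm measurableSet_Iic, Measure.restrict_apply measurableSet_Iic]
  exact le_antisymm (hup s) (hlow s)

/-- If the increments of `f` are bounded by the measure `κ`, then so are the measures of images. -/
theorem volume_inter_image_le {κ : Measure ℝ} [IsFiniteMeasure κ] [NullSingletonClass κ] {l : ℝ}
    (hκ : κ (Ioo 0 l)ᶜ = 0) {f : ℝ → ℝ}
    (hfκ : ∀ x ∈ Ioo 0 l, ∀ y ∈ Ioo 0 l, x ≤ y → |f y - f x| ≤ κ.real (Ioc x y))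
    {B : Set ℝ} (hB : MeasurableSet B) :
    volume (B ∩ f '' Ioo 0 l) ≤ κ (f ⁻¹' B) := by
  set P : ℝ → ℝ := fun x => κ.real (Iic x) with hP
  have hPm : Measurable P := measurable_cdf κ id
  have hPd : ∀ x y, x ≤ y → κ.real (Ioc x y) = P y - P x := by
    intro x y hxy
    rw [← Iic_sdiff_Iic, measureReal_sdiff (Iic_subset_Iic.2 hxy) measurableSet_Iic]
  have hdist : ∀ x ∈ Ioo 0 l, ∀ y ∈ Ioo 0 l, |f y - f x| ≤ |P y - P x| := by
    intro x hx y hy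
    rcases le_total x y with h | h
    · exact (hfκ x hx y hy h).trans ((hPd x y h).trans_le (le_abs_self _))
    · rw [abs_sub_comm, abs_sub_comm (P y)]
      exact (hfκ y hy x hx h).trans ((hPd y x h).trans_le (le_abs_self _))
  -- Since `f` varies no more than `P`, it factors as `φ ∘ P` with `φ` 1-Lipschitz. Such a `φ` does
  -- not increase length, and `P` carries `κ` to Lebesgue measure.
  choose! r hr hrP using fun (s : ℝ) (hs : s ∈ P '' Ioo 0 l) => hs
  have hLip : LipschitzOnWith 1 (fun s => f (r s)) (P '' Ioo 0 l) := by
    refine LipschitzOnWith.of_dist_le_mul fun s hs s' hs' => ?_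
    rw [NNReal.coe_one, one_mul, Real.dist_eq, Real.dist_eq]
    have := hdist _ (hr s' hs') _ (hr s hs)
    rwa [hrP s hs, hrP s' hs'] at this
  obtain ⟨φ, hφ, hφeq⟩ := hLip.extend_real
  have hφP : ∀ x ∈ Ioo 0 l, φ (P x) = f x := by
    intro x hx
    have hmem : P x ∈ P '' Ioo 0 l := mem_image_of_mem _ hx
    rw [← hφeq hmem]
    have := hdist x hx _ (hr _ hmem)
    rw [hrP _ hmem, sub_self, abs_zero] at this
    exact sub_eq_zero.1 (abs_nonpos_iff.1 this)
  have hsub : B ∩ f '' Ioo 0 l ⊆ φ '' (φ ⁻¹' B ∩ Icc 0 (κ.real univ)) := by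
    rintro _ ⟨hb, x, hx, rfl⟩
    refine ⟨P x, ⟨?_, measureReal_nonneg, measureReal_mono (subset_univ _)⟩, hφP x hx⟩
    rwa [mem_preimage, hφP x hx]
  have hφB : MeasurableSet (φ ⁻¹' B) := hφ.continuous.measurable hB
  calc volume (B ∩ f '' Ioo 0 l) ≤ volume (φ '' (φ ⁻¹' B ∩ Icc 0 (κ.real univ))) :=
        measure_mono hsub
    _ ≤ volume (φ ⁻¹' B ∩ Icc 0 (κ.real univ)) := by
        have := hφ.hausdorffMeasure_image_le zero_le_one (φ ⁻¹' B ∩ Icc 0 (κ.real univ))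
        rwa [hausdorffMeasure_real, ENNReal.rpow_one, ENNReal.coe_one, one_mul] at this
    _ = κ (P ⁻¹' (φ ⁻¹' B)) := by
        rw [← Measure.restrict_apply hφB, ← map_measureReal_Iic hκ, Measure.map_apply hPm hφB]
    _ ≤ κ (f ⁻¹' B) := by
        have hae : ∀ᵐ x ∂κ, x ∈ Ioo 0 l := by rwa [ae_iff]
        refine measure_mono_ae ?_
        filter_upwards [hae] with x hx hxB
        have hxB' : φ (P x) ∈ B := hxB
        rwa [hφP x hx] at hxB'

theorem abs_integral_mul_normed_sub_le {f : ℝ → ℝ} (hf : Continuous f) {x δ : ℝ}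
    (a : ContDiffBump x) (h : ∀ s ∈ Metric.ball x a.rOut, |f s - f x| ≤ δ) :
    |(∫ s, f s * a.normed volume s) - f x| ≤ δ := by
  have hi1 : Integrable (a.normed volume) := a.integrable_normed
  have hi2 : Integrable fun s => f s * a.normed volume s :=
    Continuous.integrable_of_hasCompactSupport (hf.mul a.continuous_normed)
      (a.hasCompactSupport_normed.mul_left)
  have h1 : (∫ s, f s * a.normed volume s) - f x = ∫ s, (f s - f x) * a.normed volume s := by
    have : f x = ∫ s, f x * a.normed volume s := by
      rw [integral_const_mul, a.integral_normed, mul_one]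
    conv_lhs => rw [this]
    rw [← integral_sub hi2 (hi1.const_mul _)]
    simp only [sub_mul]
  have h2 : δ = ∫ s, δ * a.normed volume s := by
    rw [integral_const_mul, a.integral_normed, mul_one]
  rw [h1]
  conv_rhs => rw [h2]
  refine norm_integral_le_of_norm_le (f := fun s => (f s - f x) * a.normed volume s)
    (hi1.const_mul _) (Filter.Eventually.of_forall fun s => ?_)
  by_cases hs : s ∈ Metric.ball x a.rOut
  · rw [norm_mul, Real.norm_eq_abs, Real.norm_of_nonneg (a.nonneg_normed s)]
    exact mul_le_mul_of_nonneg_right (h s hs) (a.nonneg_normed s)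
  · have : a.normed volume s = 0 := by
      rw [← a.support_normed_eq (μ := volume)] at hs
      exact Function.notMem_support.1 hs
    simp [this]

/-! ### Weak derivatives control increments. -/

namespace CompactMetricGraph

/-- The test function is a smoothed indicator of `[x, y]`, the primitive of a bump at `x` minus a
bump at `y`. Testing against it gives nearly `f x - f y` on one side, and at most `∫ |g|` over a
slightly larger interval on the other. -/
theorem IsWeakDeriv.abs_sub_le {l : ℝ} {f g : ℝ → ℝ} (h : IsWeakDeriv l f g) (hf : Continuous f)
    (hg : IntegrableOn g (Ioo 0 l)) {x y : ℝ} (hx : 0 < x) (hxy : x ≤ y) (hy : y < l) :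
    |f y - f x| ≤ ∫ s in x..y, (Ioo 0 l).indicator (fun s => |g s|) s := by
  set q : ℝ → ℝ := (Ioo 0 l).indicator fun s => |g s| with hq
  have hqi : Integrable q := (integrable_indicator_iff measurableSet_Ioo).2 hg.abs
  have hq0 : 0 ≤ q := indicator_nonneg fun s _ => abs_nonneg _
  set G : ℝ → ℝ := fun z => ∫ s in (0 : ℝ)..z, q s with hG
  have hGc : Continuous G := intervalIntegral.continuous_primitive
    (fun a b => hqi.intervalIntegrable) 0
  have hGd : ∀ a b, ∫ s in a..b, q s = G b - G a := fun a b =>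
    (intervalIntegral.integral_interval_sub_left hqi.intervalIntegrable
      hqi.intervalIntegrable).symm
  have key : ∀ δ > 0, ∃ ε₀ > 0, ∀ ε, 0 < ε → ε < ε₀ →
      |f y - f x| ≤ 2 * δ + (G (y + ε) - G (x - ε)) := by
    intro δ hδ
    obtain ⟨ε₁, hε₁, hx₁⟩ := Metric.continuousAt_iff.1 (hf.continuousAt (x := x)) δ hδ
    obtain ⟨ε₂, hε₂, hy₂⟩ := Metric.continuousAt_iff.1 (hf.continuousAt (x := y)) δ hδ
    refine ⟨min (min ε₁ ε₂) (min x (l - y)), by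
      simp only [gt_iff_lt, lt_min_iff]; exact ⟨⟨hε₁, hε₂⟩, hx, by linarith⟩, ?_⟩
    intro ε hε hεlt
    simp only [lt_min_iff] at hεlt
    obtain ⟨⟨hlt1, hlt2⟩, hlt3, hlt4⟩ := hεlt
    let a : ContDiffBump x := ⟨ε / 2, ε, by positivity, by linarith⟩
    let b : ContDiffBump y := ⟨ε / 2, ε, by positivity, by linarith⟩
    have ha := abs_integral_mul_normed_sub_le hf a (δ := δ) fun s hs =>
      (hx₁ (lt_trans (Metric.mem_ball.1 hs) hlt1)).le
    have hb := abs_integral_mul_normed_sub_le hf b (δ := δ) fun s hs =>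
      (hy₂ (lt_trans (Metric.mem_ball.1 hs) hlt2)).le
    set ρ : ℝ → ℝ := a.normed volume with hρ
    set σ : ℝ → ℝ := b.normed volume with hσ
    have hρc : Continuous ρ := a.continuous_normed
    have hσc : Continuous σ := b.continuous_normed
    have hρs : Function.support ρ ⊆ Ioo (x - ε) (x + ε) := by
      rw [hρ, a.support_normed_eq, Real.ball_eq_Ioo]
    have hσs : Function.support σ ⊆ Ioo (y - ε) (y + ε) := by
      rw [hσ, b.support_normed_eq, Real.ball_eq_Ioo]
    have hρs' : Function.support ρ ⊆ Ioo (x - ε) (y + ε) :=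
      hρs.trans (Ioo_subset_Ioo_right (by linarith))
    have hσs' : Function.support σ ⊆ Ioo (x - ε) (y + ε) :=
      hσs.trans (Ioo_subset_Ioo_left (by linarith))
    set ψ : ℝ → ℝ := fun s => ρ s - σ s with hψ
    have hψc : Continuous ψ := hρc.sub hσc
    have hψs : Function.support ψ ⊆ Ioo (x - ε) (y + ε) := by
      intro s hs
      by_contra hcon
      refine hs ?_
      have h1 : ρ s = 0 := Function.notMem_support.1 fun h => hcon (hρs' h)
      have h2 : σ s = 0 := Function.notMem_support.1 fun h => hcon (hσs' h)
      simp [hψ, h1, h2]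
    set φ : ℝ → ℝ := fun z => ∫ s in (x - ε)..z, ψ s with hφ
    have hφd : ∀ z, HasDerivAt φ (ψ z) z := fun z =>
      intervalIntegral.integral_hasDerivAt_right (hψc.intervalIntegrable _ _)
        hψc.stronglyMeasurable.stronglyMeasurableAtFilter hψc.continuousAt
    have hφderiv : deriv φ = ψ := funext fun z => (hφd z).deriv
    have hψsm : ContDiff ℝ ∞ ψ := a.contDiff_normed.sub b.contDiff_normed
    have hφsm : ContDiff ℝ ∞ φ := by
      rw [contDiff_infty_iff_deriv, hφderiv]
      exact ⟨fun z => (hφd z).differentiableAt, hψsm⟩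
    have hφsplit : ∀ z, φ z = (∫ s in (x - ε)..z, ρ s) - ∫ s in (x - ε)..z, σ s := fun z =>
      intervalIntegral.integral_sub (hρc.intervalIntegrable _ _) (hσc.intervalIntegrable _ _)
    have hρ1 : ∫ s, ρ s = 1 := a.integral_normed
    have hσ1 : ∫ s, σ s = 1 := b.integral_normed
    -- Beyond `y + ε` the two bumps cancel, each having integral `1`.
    have hφsupp : ∀ z, z ∉ Icc (x - ε) (y + ε) → φ z = 0 := by
      intro z hz
      rcases lt_or_ge z (x - ε) with h1 | h1
      · refine (intervalIntegral.integral_congr (g := fun _ => 0) fun s hs => ?_).trans (by simp)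
        rw [uIcc_of_ge h1.le] at hs
        exact Function.notMem_support.1 fun h => by linarith [(hψs h).1, hs.2]
      · have h2 : y + ε < z := by
          by_contra hcon
          exact hz ⟨h1, not_lt.1 hcon⟩
        have hsub : Ioo (x - ε) (y + ε) ⊆ Ioc (x - ε) z := fun s hs =>
          ⟨hs.1, (hs.2.trans h2).le⟩
        rw [hφsplit, intervalIntegral.integral_eq_integral_of_support_subset (hρs'.trans hsub),
          intervalIntegral.integral_eq_integral_of_support_subset (hσs'.trans hsub), hρ1, hσ1,
          sub_self]
    have hφ1 : ∀ z, |φ z| ≤ 1 := by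
      intro z
      rcases lt_or_ge z (x - ε) with h1 | h1
      · rw [hφsupp z fun h => by linarith [h.1], abs_zero]
        exact zero_le_one
      have hρi : Integrable ρ := a.integrable_normed
      have hσi : Integrable σ := b.integrable_normed
      have e1 : 0 ≤ ∫ s in (x - ε)..z, ρ s :=
        intervalIntegral.integral_nonneg_of_forall h1 a.nonneg_normed
      have e2 : 0 ≤ ∫ s in (x - ε)..z, σ s :=
        intervalIntegral.integral_nonneg_of_forall h1 b.nonneg_normed
      have e3 : ∫ s in (x - ε)..z, ρ s ≤ 1 := by
        rw [intervalIntegral.integral_of_le h1, ← hρ1]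
        exact setIntegral_le_integral hρi (Filter.Eventually.of_forall a.nonneg_normed)
      have e4 : ∫ s in (x - ε)..z, σ s ≤ 1 := by
        rw [intervalIntegral.integral_of_le h1, ← hσ1]
        exact setIntegral_le_integral hσi (Filter.Eventually.of_forall b.nonneg_normed)
      rw [hφsplit, abs_le]
      constructor <;> linarith
    have hφts : tsupport φ ⊆ Icc (x - ε) (y + ε) :=
      closure_minimal (fun z hz => by_contra fun hcon => hz (hφsupp z hcon)) isClosed_Icc
    have hIcc : Icc (x - ε) (y + ε) ⊆ Ioo 0 l := fun z hz =>
      ⟨by linarith [hz.1], by linarith [hz.2]⟩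
    have hweak := h φ hφsm (HasCompactSupport.of_support_subset_isCompact isCompact_Icc
      ((subset_tsupport φ).trans hφts)) (hφts.trans hIcc)
    rw [hφderiv] at hweak
    have hleft : ∫ s in Ioo 0 l, f s * ψ s = (∫ s, f s * ρ s) - ∫ s, f s * σ s := by
      rw [setIntegral_eq_integral_of_forall_compl_eq_zero, ← integral_sub]
      · simp only [hψ, mul_sub]
      · exact Continuous.integrable_of_hasCompactSupport (hf.mul hρc)
          a.hasCompactSupport_normed.mul_left
      · exact Continuous.integrable_of_hasCompactSupport (hf.mul hσc)
          b.hasCompactSupport_normed.mul_left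
      · intro s hs
        have : ψ s = 0 := Function.notMem_support.1 fun h =>
          hs (hIcc (Ioo_subset_Icc_self (hψs h)))
        rw [this, mul_zero]
    have hright : |∫ s in Ioo 0 l, g s * φ s| ≤ G (y + ε) - G (x - ε) := by
      rw [← hGd, intervalIntegral.integral_of_le (by linarith), ← integral_Icc_eq_integral_Ioc]
      have e : ∫ s in Icc (x - ε) (y + ε), q s =
          ∫ s in Ioo 0 l, (Icc (x - ε) (y + ε)).indicator q s := by
        rw [setIntegral_indicator measurableSet_Icc, inter_eq_self_of_subset_right hIcc]
      rw [e]
      refine norm_integral_le_of_norm_le (f := fun s => g s * φ s)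
        (hqi.indicator measurableSet_Icc).integrableOn ?_
      rw [ae_restrict_iff' measurableSet_Ioo]
      refine Filter.Eventually.of_forall fun s hs => ?_
      by_cases hs' : s ∈ Icc (x - ε) (y + ε)
      · rw [indicator_of_mem hs', hq, indicator_of_mem hs, norm_mul, Real.norm_eq_abs,
          Real.norm_eq_abs]
        exact mul_le_of_le_one_right (abs_nonneg _) (hφ1 s)
      · rw [indicator_of_notMem hs', hφsupp s hs']
        simp
    rw [hleft] at hweak
    rw [abs_le] at ha hb hright ⊢
    constructor <;> linarith [ha.1, ha.2, hb.1, hb.2, hright.1, hright.2]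
  have hlim : Filter.Tendsto (fun ε => G (y + ε) - G (x - ε)) (nhdsWithin 0 (Ioi 0))
      (nhds (G (y + 0) - G (x - 0))) :=
    (Continuous.tendsto (by fun_prop) 0).mono_left nhdsWithin_le_nhds
  rw [hGd]
  refine le_of_forall_pos_le_add fun δ hδ => ?_
  obtain ⟨ε₀, hε₀, hkey⟩ := key (δ / 2) (by positivity)
  have := ge_of_tendsto (hlim.const_add (2 * (δ / 2))) (by
    filter_upwards [Ioo_mem_nhdsGT hε₀] with ε hε using hkey ε hε.1 hε.2)
  simp only [add_zero, sub_zero] at this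
  linarith

end CompactMetricGraph

/-! ### Integration on the graph and covering of values. -/

theorem measurable_of_sigma {ι Y : Type*} [MeasurableSpace Y] {F : (Σ _ : ι, ℝ) → Y}
    (hF : ∀ i, Measurable fun x => F ⟨i, x⟩) : Measurable F := fun _ hs =>
  MeasurableSpace.measurableSet_iInf.2 fun i => hF i hs

theorem measurable_sigma_mk {ι : Type*} (i : ι) :
    Measurable (Sigma.mk (β := fun _ => ℝ) i) := fun _ hs =>
  MeasurableSpace.measurableSet_iInf.1 hs i

namespace CompactMetricGraph

variable {V E : Type*} (G : CompactMetricGraph V E)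

theorem continuous_edgePoint (e : E) : Continuous (G.edgePoint e) := by
  let _ : TopologicalSpace V := ⊥
  have h1 : Continuous (fun x : Icc (0 : ℝ) (G.length e) =>
      (Sum.inr ⟨e, x⟩ : V ⊕ (Σ e : E, Icc (0 : ℝ) (G.length e)))) :=
    continuous_inr.comp continuous_sigmaMk
  exact (continuous_quot_mk (r := G.Glue)).comp h1

theorem compactSpace_point [Finite V] [Finite E] : CompactSpace G.Point := by
  let _ : TopologicalSpace V := ⊥
  have : CompactSpace (V ⊕ (Σ e : E, Icc (0 : ℝ) (G.length e))) := inferInstance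
  have h2 : CompactSpace G.PrePoint := this
  exact Quot.compactSpace

theorem continuous_edgeFun (u : C(G.Point, ℝ)) (e : E) : Continuous (G.edgeFun u e) :=
  u.continuous.comp ((G.continuous_edgePoint e).comp continuous_projIcc)

/-- Every point of the graph is a node or an interior point of an edge. -/
theorem exists_node_or_edgeFun (u : C(G.Point, ℝ)) (P : G.Point) :
    (∃ v : V, u P = u (Quot.mk _ (Sum.inl v))) ∨
      ∃ e, ∃ x ∈ Ioo 0 (G.length e), u P = G.edgeFun u e x := by
  induction P using Quot.ind with | mk P =>
  rcases P with v | ⟨e, x, hx⟩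
  · exact Or.inl ⟨v, rfl⟩
  rcases hx.1.eq_or_lt with h0 | h0
  · subst h0
    exact Or.inl ⟨_, congrArg u (Quot.sound (Glue.source e)).symm⟩
  rcases hx.2.eq_or_lt with hl | hl
  · subst hl
    exact Or.inl ⟨_, congrArg u (Quot.sound (Glue.target e)).symm⟩
  refine Or.inr ⟨e, x, ⟨h0, hl⟩, ?_⟩
  rw [edgeFun, projIcc_of_mem _ hx]
  rfl

theorem normLp_pow [Fintype E] {n : ℕ} (hn : n ≠ 0) (f : E → ℝ → ℝ) :
    G.normLp n f ^ n = ∑ e, ∫ x in Ioo 0 (G.length e), |f e x| ^ n := by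
  have h1 : ∀ e, ∫ x in (0 : ℝ)..G.length e, |f e x| ^ (n : ℝ) =
      ∫ x in Ioo 0 (G.length e), |f e x| ^ n := fun e => by
    rw [intervalIntegral.integral_of_le (G.length_pos e).le, integral_Ioc_eq_integral_Ioo]
    simp only [Real.rpow_natCast]
  have h2 : 0 ≤ ∑ e, ∫ x in Ioo 0 (G.length e), |f e x| ^ n :=
    Finset.sum_nonneg fun e _ => integral_nonneg fun x => by positivity
  rw [normLp, Finset.sum_congr rfl fun e _ => h1 e, one_div, Real.rpow_inv_natCast_pow h2 hn]

/-- The length measure on the disjoint union of the open edges. -/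
noncomputable def edgeMeasure [Fintype E] : Measure (Σ _ : E, ℝ) :=
  ∑ e, (volume.restrict (Ioo 0 (G.length e))).map (Sigma.mk e)

theorem lintegral_edgeMeasure [Fintype E] {F : (Σ _ : E, ℝ) → ENNReal} (hF : Measurable F) :
    ∫⁻ x, F x ∂G.edgeMeasure = ∑ e, ∫⁻ x in Ioo 0 (G.length e), F ⟨e, x⟩ := by
  rw [edgeMeasure, lintegral_finsetSum_measure]
  exact Finset.sum_congr rfl fun e _ => lintegral_map hF (measurable_sigma_mk e)

theorem edgeMeasure_univ [Fintype E] :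
    G.edgeMeasure univ = ENNReal.ofReal (∑ e, G.length e) := by
  rw [← lintegral_one, G.lintegral_edgeMeasure measurable_const,
    ENNReal.ofReal_sum_of_nonneg fun e _ => (G.length_pos e).le]
  exact Finset.sum_congr rfl fun e _ => by simp

instance [Fintype E] : IsFiniteMeasure G.edgeMeasure :=
  ⟨by rw [edgeMeasure_univ]; exact ENNReal.ofReal_lt_top⟩

theorem ofReal_sum_integral [Fintype E] {f : E → ℝ → ℝ}
    (hf : ∀ e, IntegrableOn (f e) (Ioo 0 (G.length e))) (h0 : ∀ e x, 0 ≤ f e x) :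
    ENNReal.ofReal (∑ e, ∫ x in Ioo 0 (G.length e), f e x) =
      ∑ e, ∫⁻ x in Ioo 0 (G.length e), ENNReal.ofReal (f e x) := by
  rw [ENNReal.ofReal_sum_of_nonneg fun e _ => integral_nonneg (h0 e)]
  exact Finset.sum_congr rfl fun e _ =>
    ofReal_integral_eq_lintegral_ofReal (hf e) (Filter.Eventually.of_forall (h0 e))

/-- On one edge, the values of `|u|` in `B` are covered with cost `∫_{|u| ∈ B} |u'|`. -/
theorem volume_inter_image_abs_edgeFun_le {u : C(G.Point, ℝ)} {g : E → ℝ → ℝ}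
    (hg : G.HasL2WeakDeriv u g) (e : E) {p : ℝ → ℝ}
    (hp : p =ᵐ[volume.restrict (Ioo 0 (G.length e))] fun x => |g e x|)
    {B : Set ℝ} (hB : MeasurableSet B) :
    volume (B ∩ (fun x => |G.edgeFun u e x|) '' Ioo 0 (G.length e)) ≤
      ∫⁻ x in Ioo 0 (G.length e),
        ((fun x => |G.edgeFun u e x|) ⁻¹' B).indicator (fun x => ENNReal.ofReal (p x)) x := by
  set l := G.length e
  have hgi : IntegrableOn (g e) (Ioo 0 l) := (hg e).1.integrable (by norm_num)
  have hpi : IntegrableOn p (Ioo 0 l) := hgi.abs.congr hp.symm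
  -- `κ = |u'| dx` is atomless and bounds the increments of `u`, hence those of `|u|`.
  set κ : Measure ℝ := (volume.restrict (Ioo 0 l)).withDensity fun x => ENNReal.ofReal (p x)
    with hκ
  have hκfin : IsFiniteMeasure κ := isFiniteMeasure_withDensity_ofReal hpi.2
  have hκac : κ ≪ volume.restrict (Ioo 0 l) := withDensity_absolutelyContinuous _ _
  have hκns : NullSingletonClass κ := ⟨fun x => hκac (measure_singleton x)⟩
  have hκc : κ (Ioo 0 l)ᶜ = 0 := hκac (by
    rw [Measure.restrict_apply measurableSet_Ioo.compl]; simp)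
  have hfc : Continuous fun x => |G.edgeFun u e x| := (G.continuous_edgeFun u e).abs
  refine (volume_inter_image_le hκc (fun x hx y hy hxy => ?_) hB).trans_eq ?_
  · refine (abs_abs_sub_abs_le_abs_sub _ _).trans ?_
    refine ((hg e).2.abs_sub_le (G.continuous_edgeFun u e) hgi hx.1 hxy hy.2).trans_eq ?_
    have hsub : Ioc x y ⊆ Ioo 0 l := fun s hs => ⟨hx.1.trans hs.1, hs.2.trans_lt hy.2⟩
    have hae : p =ᵐ[volume.restrict (Ioc x y)] fun x => |g e x| :=
      ae_restrict_of_ae_restrict_of_subset hsub hp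
    have e1 : ∫ s in x..y, (Ioo 0 l).indicator (fun s => |g e s|) s = ∫ s in Ioc x y, p s := by
      rw [intervalIntegral.integral_of_le hxy, integral_congr_ae hae]
      exact setIntegral_congr_fun measurableSet_Ioc fun s hs => indicator_of_mem (hsub hs) _
    have hp0 : 0 ≤ᵐ[volume.restrict (Ioc x y)] p := by
      filter_upwards [hae] with s hs
      rw [hs]
      exact abs_nonneg _
    rw [e1, measureReal_def, hκ, withDensity_apply _ measurableSet_Ioc,
      Measure.restrict_restrict measurableSet_Ioc, inter_eq_self_of_subset_left hsub,
      ← ofReal_integral_eq_lintegral_ofReal (hpi.mono_set hsub) hp0,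
      ENNReal.toReal_ofReal (integral_nonneg_of_ae hp0)]
  · have hm := hfc.measurable hB
    rw [hκ, withDensity_apply _ hm, lintegral_indicator hm]

/-- The values of `|u|` cover the interval between its bounds, by connectedness. -/
theorem setLIntegral_Ioc_le [Finite V] [Fintype E] (hconn : ConnectedSpace G.Point)
    {u : C(G.Point, ℝ)} {g : E → ℝ → ℝ} (hg : G.HasL2WeakDeriv u g)
    {p : (Σ _ : E, ℝ) → ℝ} (hpm : Measurable p)
    (hp : ∀ e, (fun x => p ⟨e, x⟩) =ᵐ[volume.restrict (Ioo 0 (G.length e))] fun x => |g e x|)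
    (a b : G.Point) {h : ℝ → ENNReal} (hh : Measurable h) :
    ∫⁻ τ in Ioc |u a| |u b|, h τ ≤
      ∫⁻ x, h |G.edgeFun u x.1 x.2| * ENNReal.ofReal (p x) ∂G.edgeMeasure := by
  set w : (Σ _ : E, ℝ) → ℝ := fun x => |G.edgeFun u x.1 x.2| with hw
  have hwm : Measurable w :=
    measurable_of_sigma fun e => (G.continuous_edgeFun u e).abs.measurable
  set Q : Measure ℝ := (G.edgeMeasure.withDensity fun x => ENNReal.ofReal (p x)).map w with hQ
  -- Domination of measures gives the inequality for every `h` at once. The finitely many node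
  -- values form a null set, so open edges suffice.
  have hle : volume.restrict (Ioc |u a| |u b|) ≤ Q := by
    refine Measure.le_iff.2 fun B hB => ?_
    rw [Measure.restrict_apply hB, hQ, Measure.map_apply hwm hB,
      withDensity_apply _ (hwm hB), ← lintegral_indicator (hwm hB),
      G.lintegral_edgeMeasure (hpm.ennreal_ofReal.indicator (hwm hB))]
    set N : Set ℝ := range fun v : V => |u (Quot.mk _ (Sum.inl v))| with hN
    have hcover : Ioc |u a| |u b| ⊆
        N ∪ ⋃ e, (fun x => |G.edgeFun u e x|) '' Ioo 0 (G.length e) := by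
      intro τ hτ
      have hpre : IsPreconnected (range fun P => |u P|) :=
        isPreconnected_range u.continuous.abs
      obtain ⟨P, rfl⟩ := hpre.Icc_subset ⟨a, rfl⟩ ⟨b, rfl⟩ (Ioc_subset_Icc_self hτ)
      rcases G.exists_node_or_edgeFun u P with ⟨v, hv⟩ | ⟨e, x, hx, hux⟩
      · exact Or.inl ⟨v, by simp only [hv]⟩
      · exact Or.inr (mem_iUnion.2 ⟨e, x, hx, by simp only [hux]⟩)
    have hN0 : volume (B ∩ N) = 0 :=
      measure_mono_null inter_subset_right ((finite_range _).measure_zero _)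
    calc volume (B ∩ Ioc |u a| |u b|)
        ≤ volume ((B ∩ N) ∪ ⋃ e, B ∩ (fun x => |G.edgeFun u e x|) '' Ioo 0 (G.length e)) := by
          rw [← inter_iUnion, ← inter_union_distrib_left]
          exact measure_mono (inter_subset_inter_right _ hcover)
      _ ≤ volume (B ∩ N) +
          ∑ e, volume (B ∩ (fun x => |G.edgeFun u e x|) '' Ioo 0 (G.length e)) :=
          (measure_union_le _ _).trans (add_le_add_right (measure_iUnion_fintype_le _ _) _)
      _ ≤ _ := by
          rw [hN0, zero_add]
          exact Finset.sum_le_sum fun e _ =>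
            G.volume_inter_image_abs_edgeFun_le hg e (hp e) hB
  have hhw : Measurable fun x => h (w x) := hh.comp hwm
  calc ∫⁻ τ in Ioc |u a| |u b|, h τ ≤ ∫⁻ τ, h τ ∂Q := lintegral_mono' hle le_rfl
    _ = ∫⁻ x, h (w x) * ENNReal.ofReal (p x) ∂G.edgeMeasure := by
      rw [hQ, lintegral_map hh hwm,
        lintegral_withDensity_eq_lintegral_mul _ hpm.ennreal_ofReal hhw]
      exact lintegral_congr fun x => mul_comm _ _

end CompactMetricGraph

/-! ### Application to the graph. -/

theorem mainTheorem3 {V E : Type*} [Finite V] [Fintype E] (G : CompactMetricGraph V E)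
    (hconn : ConnectedSpace G.Point) (hterm : ∃ e, G.IsTerminalEdge e) :
    ∃ C : ℝ, 0 < C ∧
      ∀ μ : ℝ, 0 < μ → μ ≤ criticalMassHalfLine → ∀ u ∈ G.H1Mass μ,
        ∃ θ ∈ Set.Icc 0 μ,
          G.normLp 6 (G.edgeFun u) ^ 6 ≤
            3 * ((μ - θ) / criticalMassHalfLine) ^ 2 * G.normLp 2 (G.weakDeriv u) ^ 2
              + C * θ ^ (1 / 2 : ℝ) := by
  have hL : 0 < ∑ e, G.length e :=
    Finset.sum_pos (fun e _ => G.length_pos e) ⟨hterm.choose, Finset.mem_univ _⟩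
  have hcrit : 0 ≤ criticalMassHalfLine := by
    have := Real.pi_pos
    rw [criticalMassHalfLine]
    positivity
  obtain ⟨C, hC, hmain⟩ := exists_pow_six_le_of_covering hL hcrit
  refine ⟨C, hC, ?_⟩
  intro μ hμ0 hμ u hu
  obtain ⟨hu1, hmass⟩ := hu
  have hg := G.hasL2WeakDeriv_weakDeriv hu1
  set g := G.weakDeriv u
  -- The weak derivative is only a.e. measurable, so a measurable representative is used.
  let p : (Σ _ : E, ℝ) → ℝ := fun x => |(hg x.1).1.1.mk (g x.1) x.2|
  have hpm : Measurable p :=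
    measurable_of_sigma fun e => (hg e).1.1.stronglyMeasurable_mk.measurable.abs
  have hp : ∀ e, (fun x => p ⟨e, x⟩) =ᵐ[volume.restrict (Ioo 0 (G.length e))]
      fun x => |g e x| := by
    intro e
    filter_upwards [(hg e).1.1.ae_eq_mk] with x hx
    simp only [p]
    rw [← hx]
  have hwm : Measurable fun x : Σ _ : E, ℝ => |G.edgeFun u x.1 x.2| :=
    measurable_of_sigma fun e => (G.continuous_edgeFun u e).abs.measurable
  have hcomp := G.compactSpace_point
  -- Both extremes of `|u|` must be attained for connectedness to cover the whole range between
  -- them.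
  obtain ⟨a, -, ha⟩ := isCompact_univ.exists_isMinOn univ_nonempty
    (u.continuous.abs.continuousOn)
  obtain ⟨b, -, hb⟩ := isCompact_univ.exists_isMaxOn univ_nonempty
    (u.continuous.abs.continuousOn)
  have hint : ∀ (n : ℕ) (e : E),
      IntegrableOn (fun x => |G.edgeFun u e x| ^ n) (Ioo 0 (G.length e)) := fun n e =>
    (((G.continuous_edgeFun u e).abs.pow n).integrableOn_Icc).mono_set Ioo_subset_Icc_self
  have hpow : ∀ n : ℕ, n ≠ 0 → ENNReal.ofReal (G.normLp n (G.edgeFun u) ^ n) =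
      ∫⁻ x, ENNReal.ofReal (|G.edgeFun u x.1 x.2| ^ n) ∂G.edgeMeasure := by
    intro n hn
    rw [G.normLp_pow hn, G.lintegral_edgeMeasure (hwm.pow_const n).ennreal_ofReal,
      G.ofReal_sum_integral (hint n) fun e x => by positivity]
  have hD : ∫⁻ x, ENNReal.ofReal (p x ^ 2) ∂G.edgeMeasure =
      ENNReal.ofReal (G.normLp (2 : ℕ) g ^ 2) := by
    rw [G.normLp_pow two_ne_zero, G.lintegral_edgeMeasure (hpm.pow_const 2).ennreal_ofReal,
      G.ofReal_sum_integral (fun e => by simp only [sq_abs]; exact (hg e).1.integrable_sq)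
        fun e x => by positivity]
    refine Finset.sum_congr rfl fun e _ => lintegral_congr_ae ?_
    filter_upwards [hp e] with x hx
    rw [hx]
  obtain ⟨θ, hθ, hfinal⟩ := hmain G.edgeMeasure (w := fun x => |G.edgeFun u x.1 x.2|) (p := p)
    (by rw [measureReal_def, G.edgeMeasure_univ, ENNReal.toReal_ofReal hL.le]) hwm hpm
    (fun x => abs_nonneg _) (fun x => abs_nonneg _) (abs_nonneg (u a))
    (fun x => ha (mem_univ _)) (fun x => hb (mem_univ _))
    (fun h hh => G.setLIntegral_Ioc_le hconn hg hpm hp a b hh)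
    (D := G.normLp (2 : ℕ) g ^ 2) (K := G.normLp (6 : ℕ) (G.edgeFun u) ^ 6)
    (sq_nonneg _) hμ0.le hμ hD.le (hpow 6 (by norm_num)).le
    (by rw [← hpow 2 two_ne_zero, ← hmass, Nat.cast_ofNat])
  refine ⟨θ, hθ, ?_⟩
  rw [Nat.cast_ofNat, Nat.cast_ofNat] at hfinal
  refine hfinal.trans_eq ?_
  have h3 : (√3 : ℝ) ^ 2 = 3 := Real.sq_sqrt (by norm_num)
  have hpi := Real.pi_pos
  have : 3 * ((μ - θ) / criticalMassHalfLine) ^ 2 = 16 / Real.pi ^ 2 * (μ - θ) ^ 2 := by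
    rw [criticalMassHalfLine, div_pow, div_pow, mul_pow, h3]
    field_simp
    norm_num
  rw [this]
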